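/- Let $\mathbb M^3$ be one of the space forms $\mathbb R^3$, $\mathbb S^3$, $\mathbb H^3$, and let $S\subset\mathbb M^3$ be a smoothly embedded 2-sphere with smooth unit normal field $N$ that is strictly convex, i.e. its second fundamental form is everywhere definite. Let $\mathbb L(\mathbb M^3)$ be the 4-manifold of oriented geodesics of $\mathbb M^3$, with its canonical neutral metric $\mathbb G$: if tangent vectors at a geodesic $\gamma$ are represented by orthogonal Jacobi fields $U$ along $\gamma$, then, up to a constant factor, $\mathbb G(U,U)=\langle \dot\gamma\times U,\nabla_{\dot\gamma}U\rangle$. An $\alpha$-plane is a totally null tangent plane of $\mathbb L(\mathbb M^3)$ which is invariant under the complex structure that rotates Jacobi fields by $90^\circ$ about $\gamma$; the other totally null planes are the $\beta$-planes. Let $\mathcal H(S)\subset\mathbb L(\mathbb M^3)$ be the set of oriented geodesics tangent to $S$, i.e. the hypersurface immersed by the unit tangent bundle of $S$ through $(x,v)\mapsto$ the geodesic through $x\in S$ with direction $v\in T_xS$, and let $\pi(x,v)=x$. (1) $\mathcal H(S)$ is a null hypersurface. Each of its tangent spaces contains exactly one $\alpha$-plane and exactly one $\beta$-plane, and both of these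 plane fields are contact structures on $\mathcal H(S)$. (2) Let $\mathcal C\subset\mathcal H(S)$ be a knot, i.e. a smooth, regular, simple closed curve $t\mapsto\gamma_t=(c(t),v(t))$, with contact curve $c=\pi(\mathcal C)$. Call $\mathcal C$ $\alpha$-Legendrian (resp. $\beta$-Legendrian) if its velocity always lies in the $\alpha$-plane (resp. $\beta$-plane). Then $\mathcal C$ is $\alpha$-Legendrian if and only if every $\gamma\in\mathcal C$ is tangent to $c$ ($\dot c(t)\in\mathbb R\,v(t)$ for all $t$). (3) For every knot $\mathcal C\subset\mathcal H(S)$, any two of the following imply the third: (i) $\mathcal C$ is $\beta$-Legendrian; (ii) every $\gamma\in\mathcal C$ is normal to $c$ ($\langle\dot c(t),v(t)\rangle=0$ for all $t$); (iii) either $c$ is a line of curvature of $S$ ($\dot c(t)$ is a principal vector for all $t$), or $S$ is umbilic at every point of $c$. (4) Write $Jw=N\times w$ for the rotation by $90^\circ$ in the tangent planes of $S$. The 1-form $\omega_{(x,v)}=-\langle d\pi(\cdot),Jv\rangle$ on $\mathcal H(S)$ is a contact form whose kernel is the field of $\alpha$-planes. The integral curves of its Reeb vector field $X$, characterised by $d\omega(X,\cdot)=0$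 and $\omega(X)=1$, are exactly the curves $t\mapsto(c(t),J\dot c(t))$ with $c$ a unit speed geodesic of $S$, that is, they consist of the oriented geodesics of $\mathbb M^3$ that are tangent to $S$ and normal to a geodesic of $S$. -/

import Mathlib

open scoped Manifold ContDiff

noncomputable section

/-- The ambient coordinate space `ℝ⁴`, with coordinates `x 0, x 1, x 2, x 3`. -/
abbrev Amb : Type := Fin 4 → ℝ

/-- The abstract 2-sphere, with Mathlib's manifold structure. -/
abbrev Sph : Type := Metric.sphere (0 : EuclideanSpace ℝ (Fin 3)) 1

instance factFinrankThree : Fact (Module.finrank ℝ (EuclideanSpace ℝ (Fin 3)) = 2 + 1) :=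
  ⟨by simp⟩

/-! ### The three space forms

For `κ = 1, 0, -1` the space form of curvature `κ` is realised in `ℝ⁴` as the unit sphere, the
affine hyperplane `x 0 = 1`, and the upper sheet of the unit hyperboloid. -/

/-- The space form: `x₀² + κ (x₁² + x₂² + x₃²) = 1`, with `x₀ > 0` if `κ ≤ 0`. -/
def spaceForm (κ : ℝ) : Set Amb :=
  {x | x 0 * x 0 + κ * (x 1 * x 1 + x 2 * x 2 + x 3 * x 3) = 1 ∧ (κ ≤ 0 → 0 < x 0)}

/-- The vector `y` is tangent to the space form at its point `x`. -/
def IsTangentAt (κ : ℝ) (x y : Amb) : Prop :=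
  x 0 * y 0 + κ * (x 1 * y 1 + x 2 * y 2 + x 3 * y 3) = 0

/-- The constant bilinear form of `ℝ⁴` which restricts to the Riemannian metric on the tangent
spaces of the space form. -/
def gMet (κ : ℝ) (y z : Amb) : ℝ :=
  κ * (y 0 * z 0) + y 1 * z 1 + y 2 * z 2 + y 3 * z 3

/-- The cross product `a × b` of two tangent vectors `a, b` of the space form at `x`:
`gMet κ (a × b) z = det (x, a, b, z)` for all tangent vectors `z` at `x`.
In particular `b ↦ a × b` is the rotation by `+90°` of the plane orthogonal to a unit vector `a`. -/
def crossAt (κ : ℝ) (x a b : Amb) : Amb := fun i =>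
  (if i = 0 then κ else 1) * (Matrix.of ![x, a, b, Pi.single i 1]).det

/-! ### The space of oriented geodesics

The oriented geodesic through `x` with unit tangent vector `y` is identified with the bivector
`x ∧ y` (two pairs `(x, y)` give the same bivector iff they lie on the same orbit of the geodesic
flow; for `κ = 0` these are the Plücker coordinates of the oriented line). -/

/-- Bivectors of `ℝ⁴`, as skew-symmetric arrays. -/
abbrev Biv : Type := Fin 4 → Fin 4 → ℝ

/-- The bivector `x ∧ y`. -/
def wedge (x y : Amb) : Biv := fun i j => x i * y j - y i * x j

/-- `X` is a vector orthogonal to the geodesic `x ∧ y` at `x`. -/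
def IsNormalTo (κ : ℝ) (x y X : Amb) : Prop :=
  IsTangentAt κ x X ∧ gMet κ y X = 0

/-- The tangent vectors of the space of oriented geodesics at `x ∧ y` are the bivectors
`x ∧ X + y ∧ Y` with `X, Y` orthogonal to the geodesic (and `X, Y` are uniquely determined). -/
def lineTangentVec (x y X Y : Amb) : Biv := wedge x X + wedge y Y

/-- The canonical neutral metric `G (x ∧ X + y ∧ Y, x ∧ X' + y ∧ Y')` at the geodesic `x ∧ y`.
Here `crossAt κ x y` is the rotation `J'` of the plane orthogonal to the geodesic. For `κ = ±1`
this is `-⟨⟨ξ, 𝕁 𝕁' ξ'⟩⟩`; for `κ = 0`, up to a constant factor, it is the invariant neutral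
Kähler metric of the space of oriented lines, the polarisation of
`(δx, δy) ↦ det (y, δx, δy)` for a variation `δx` of the point and `δy` of the direction. -/
def neutralMetric (κ : ℝ) (x y X Y X' Y' : Amb) : ℝ :=
  gMet κ X (crossAt κ x y Y') - gMet κ Y (crossAt κ x y X')

/-- `A` is a totally null plane of the neutral metric in the tangent space at `x ∧ y`. -/
structure IsTotallyNullPlane (κ : ℝ) (x y : Amb) (A : Submodule ℝ Biv) : Prop where
  finrank_eq : Module.finrank ℝ A = 2
  tangent : ∀ ξ ∈ A, ∃ X Y, IsNormalTo κ x y X ∧ IsNormalTo κ x y Y ∧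
    ξ = lineTangentVec x y X Y
  null : ∀ X Y X' Y', IsNormalTo κ x y X → IsNormalTo κ x y Y →
    IsNormalTo κ x y X' → IsNormalTo κ x y Y' →
    lineTangentVec x y X Y ∈ A → lineTangentVec x y X' Y' ∈ A →
    neutralMetric κ x y X Y X' Y' = 0

/-- `A` is invariant under the complex structure
`𝕁' (x ∧ X + y ∧ Y) = x ∧ J' X + y ∧ J' Y` that rotates about the geodesic by `90°`. -/
def IsRotationInvariant (κ : ℝ) (x y : Amb) (A : Submodule ℝ Biv) : Prop :=
  ∀ X Y, IsNormalTo κ x y X → IsNormalTo κ x y Y → lineTangentVec x y X Y ∈ A →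
    lineTangentVec x y (crossAt κ x y X) (crossAt κ x y Y) ∈ A

/-- An `α`-plane: a totally null plane in the family preserved by the complex structure `𝕁'`. -/
def IsAlphaPlane (κ : ℝ) (x y : Amb) (A : Submodule ℝ Biv) : Prop :=
  IsTotallyNullPlane κ x y A ∧ IsRotationInvariant κ x y A

/-- A `β`-plane: a totally null plane in the other of the two families. -/
def IsBetaPlane (κ : ℝ) (x y : Amb) (A : Submodule ℝ Biv) : Prop :=
  IsTotallyNullPlane κ x y A ∧ ¬ IsRotationInvariant κ x y A

/-! ### Strictly convex spheres -/

/-- The differential at `p` of a map of the 2-sphere to `ℝ⁴`. -/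
def dSph (f : Sph → Amb) (p : Sph) : EuclideanSpace ℝ (Fin 2) →L[ℝ] Amb :=
  mfderiv (𝓡 2) 𝓘(ℝ, Amb) f p

/-- `φ` is a smooth embedding of the 2-sphere in the space form. -/
structure IsEmbeddedSphere (κ : ℝ) (φ : Sph → Amb) : Prop where
  smooth : ContMDiff (𝓡 2) 𝓘(ℝ, Amb) ∞ φ
  mem : ∀ p, φ p ∈ spaceForm κ
  injective : Function.Injective φ
  immersion : ∀ p, Function.Injective (dSph φ p)

/-- `N` is a smooth unit normal vector field of the surface `φ` in the space form. -/
structure IsUnitNormal (κ : ℝ) (φ N : Sph → Amb) : Prop where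
  smooth : ContMDiff (𝓡 2) 𝓘(ℝ, Amb) ∞ N
  tangent : ∀ p, IsTangentAt κ (φ p) (N p)
  unit : ∀ p, gMet κ (N p) (N p) = 1
  normal : ∀ p w, gMet κ (N p) (dSph φ p w) = 0

/-- The second fundamental form `h (w, w') = -⟨dN w, dφ w'⟩`. -/
def secondForm (κ : ℝ) (φ N : Sph → Amb) (p : Sph) (w w' : EuclideanSpace ℝ (Fin 2)) : ℝ :=
  -gMet κ (dSph N p w) (dSph φ p w')

/-- Strict convexity: no normal curvature vanishes. As the tangent planes are two-dimensional,
this says that the second fundamental form is definite, i.e. that `k₁ k₂ > 0`, everywhere. -/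
def IsStrictlyConvex (κ : ℝ) (φ N : Sph → Amb) : Prop :=
  ∀ p w, w ≠ 0 → secondForm κ φ N p w w ≠ 0

/-- The surface is umbilic at `p`: the shape operator is a multiple of the identity. -/
def IsUmbilicAt (φ N : Sph → Amb) (p : Sph) : Prop :=
  ∃ k : ℝ, ∀ w, dSph N p w = k • dSph φ p w

/-! ### The tangent hypersurface

The tangent hypersurface `H(S)` is the image of the unit tangent bundle of `S` under the immersion
`(x, v) ↦ x ∧ v`. Its points are given below by `p : Sph` and a unit vector `v` tangent to `S` at
`φ p`; the projection `π : H(S) → S` is `(p, v) ↦ φ p`. -/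

/-- The unit tangent vectors of the surface at the point `φ p`. -/
def unitTangent (κ : ℝ) (φ : Sph → Amb) (p : Sph) : Set Amb :=
  {v | (∃ w, dSph φ p w = v) ∧ gMet κ v v = 1}

/-- `(q, v)` is a smooth map from the open subset `O` of `E` to the unit tangent bundle. -/
structure IsSmoothMapOn {E : Type} [NormedAddCommGroup E] [NormedSpace ℝ E]
    (κ : ℝ) (φ : Sph → Amb) (O : Set E) (q : E → Sph) (v : E → Amb) : Prop where
  isOpen : IsOpen O
  smooth_fst : ContMDiffOn 𝓘(ℝ, E) (𝓡 2) ∞ q O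
  smooth_snd : ContDiffOn ℝ ∞ v O
  mem : ∀ y ∈ O, v y ∈ unitTangent κ φ (q y)

/-- The tangent vectors of the unit tangent bundle at `(p, v)`, as the velocities `(x', v')`
in `ℝ⁴ × ℝ⁴` of its smooth curves. -/
def bundleTangent (κ : ℝ) (φ : Sph → Amb) (p : Sph) (v : Amb) : Set (Amb × Amb) :=
  {τ | ∃ (I : Set ℝ) (q : ℝ → Sph) (w : ℝ → Amb), IsSmoothMapOn κ φ I q w ∧ (0 : ℝ) ∈ I ∧
    q 0 = p ∧ w 0 = v ∧ HasDerivAt (fun t => φ (q t)) τ.1 0 ∧ HasDerivAt w τ.2 0}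

/-- The differential at `(x, v)` of the map `(x, v) ↦ x ∧ v`. -/
def dLine (x v : Amb) (τ : Amb × Amb) : Biv := wedge τ.1 v + wedge x τ.2

/-- The tangent space of `H(S)` at the oriented geodesic `φ p ∧ v`. -/
def hypTangent (κ : ℝ) (φ : Sph → Amb) (p : Sph) (v : Amb) : Set Biv :=
  dLine (φ p) v '' bundleTangent κ φ p v

/-- `H(S)` is null at `φ p ∧ v`: the metric induced on the tangent space is degenerate. -/
def IsNullAt (κ : ℝ) (φ : Sph → Amb) (p : Sph) (v : Amb) : Prop :=
  ∃ X Y, IsNormalTo κ (φ p) v X ∧ IsNormalTo κ (φ p) v Y ∧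
    lineTangentVec (φ p) v X Y ≠ 0 ∧ lineTangentVec (φ p) v X Y ∈ hypTangent κ φ p v ∧
    ∀ X' Y', IsNormalTo κ (φ p) v X' → IsNormalTo κ (φ p) v Y' →
      lineTangentVec (φ p) v X' Y' ∈ hypTangent κ φ p v →
      neutralMetric κ (φ p) v X Y X' Y' = 0

/-! ### Contact structures on the tangent hypersurface -/

/-- A field of 1-forms on the unit tangent bundle: `η p v` is evaluated on the tangent vectors
`(x', v')` at `(p, v)`. -/
abbrev FormField : Type := Sph → Amb → (Amb × Amb) →L[ℝ] ℝ

/-- `(q, v)` is a local parametrisation, defined on the open set `O ⊆ ℝ³`, of the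
three-dimensional unit tangent bundle. -/
def IsParam (κ : ℝ) (φ : Sph → Amb) (O : Set (EuclideanSpace ℝ (Fin 3)))
    (q : EuclideanSpace ℝ (Fin 3) → Sph) (v : EuclideanSpace ℝ (Fin 3) → Amb) : Prop :=
  IsSmoothMapOn κ φ O q v ∧
    ∀ y ∈ O, Function.Injective (fderiv ℝ (fun z => (φ (q z), v z)) y)

/-- The 1-form `η` in the local parametrisation `(q, v)`. -/
def pullForm (φ : Sph → Amb) (η : FormField) (q : EuclideanSpace ℝ (Fin 3) → Sph)
    (v : EuclideanSpace ℝ (Fin 3) → Amb) (y : EuclideanSpace ℝ (Fin 3)) :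
    EuclideanSpace ℝ (Fin 3) →L[ℝ] ℝ :=
  (η (q y) (v y)).comp (fderiv ℝ (fun z => (φ (q z), v z)) y)

/-- The exterior derivative of a 1-form on (an open subset of) `ℝ³`. -/
def dForm (θ : EuclideanSpace ℝ (Fin 3) → EuclideanSpace ℝ (Fin 3) →L[ℝ] ℝ)
    (y a b : EuclideanSpace ℝ (Fin 3)) : ℝ :=
  fderiv ℝ θ y a b - fderiv ℝ θ y b a

/-- The 3-form `θ ∧ dθ`. -/
def wedgeDForm (θ : EuclideanSpace ℝ (Fin 3) → EuclideanSpace ℝ (Fin 3) →L[ℝ] ℝ)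
    (y a b c : EuclideanSpace ℝ (Fin 3)) : ℝ :=
  θ y a * dForm θ y b c + θ y b * dForm θ y c a + θ y c * dForm θ y a b

/-- `η` is a contact form (smooth, and `η ∧ dη` vanishes nowhere). -/
def IsContactForm (κ : ℝ) (φ : Sph → Amb) (η : FormField) : Prop :=
  ∀ O q v, IsParam κ φ O q v → ContDiffOn ℝ ∞ (pullForm φ η q v) O ∧
    ∀ y ∈ O, ∃ a b c, wedgeDForm (pullForm φ η q v) y a b c ≠ 0

/-- The kernel of `η` is the field `D` of planes tangent to `H(S)`. -/
def IsDefiningForm (κ : ℝ) (φ : Sph → Amb) (D : Sph → Amb → Submodule ℝ Biv)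
    (η : FormField) : Prop :=
  ∀ p, ∀ v ∈ unitTangent κ φ p, ∀ τ ∈ bundleTangent κ φ p v,
    η p v τ = 0 ↔ dLine (φ p) v τ ∈ D p v

/-- The plane field `D` on `H(S)` is contact. -/
def IsContact (κ : ℝ) (φ : Sph → Amb) (D : Sph → Amb → Submodule ℝ Biv) : Prop :=
  ∃ η : FormField, IsDefiningForm κ φ D η ∧ IsContactForm κ φ η

/-- `τ` is the Reeb vector of `η` at `(p, v)`: `η (τ) = 1` and `dη (τ, ·) = 0`. -/
def IsReebVector (κ : ℝ) (φ : Sph → Amb) (η : FormField) (p : Sph) (v : Amb)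
    (τ : Amb × Amb) : Prop :=
  η p v τ = 1 ∧ ∀ O q w, IsParam κ φ O q w → ∀ y ∈ O, q y = p → w y = v →
    ∀ a, fderiv ℝ (fun z => (φ (q z), w z)) y a = τ →
      ∀ b, dForm (pullForm φ η q w) y a b = 0

/-- The 1-form `(x', v') ↦ -⟨x', v^⊥⟩`, where `v^⊥ = N × v` is `v` rotated by `90°` in the tangent
plane of the surface. -/
def alphaForm (κ : ℝ) (φ N : Sph → Amb) : FormField := fun p v =>
  -LinearMap.toContinuousLinearMap
    { toFun := fun τ => gMet κ τ.1 (crossAt κ (φ p) (N p) v)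
      map_add' := fun a b => by simp [gMet]; ring
      map_smul' := fun r a => by simp [gMet]; ring }

/-! ### Knots -/

/-- A knot in `H(S)`: a smooth, regular, closed and simple curve `t ↦ φ (q t) ∧ v t`. Its contact
curve is `t ↦ φ (q t)`. -/
structure IsKnot (κ : ℝ) (φ : Sph → Amb) (q : ℝ → Sph) (v : ℝ → Amb) : Prop where
  smooth : IsSmoothMapOn κ φ Set.univ q v
  regular : ∀ t, (deriv (fun s => φ (q s)) t, deriv v t) ≠ 0
  closed_simple : ∃ T : ℝ, 0 < T ∧ (∀ t, q (t + T) = q t ∧ v (t + T) = v t) ∧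
    ∀ s ∈ Set.Ico 0 T, ∀ t ∈ Set.Ico 0 T, q s = q t → v s = v t → s = t

/-- The velocity of the curve `t ↦ φ (q t) ∧ v t` of oriented geodesics lies in `D`. -/
def IsLegendrian (φ : Sph → Amb) (D : Sph → Amb → Submodule ℝ Biv) (q : ℝ → Sph)
    (v : ℝ → Amb) : Prop :=
  ∀ t, deriv (fun s => wedge (φ (q s)) (v s)) t ∈ D (q t) (v t)

/-- The oriented geodesics of the curve are tangent to the contact curve. -/
def IsTangentToContactCurve (φ : Sph → Amb) (q : ℝ → Sph) (v : ℝ → Amb) : Prop :=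
  ∀ t, ∃ r : ℝ, deriv (fun s => φ (q s)) t = r • v t

/-- The oriented geodesics of the curve are normal to the contact curve. -/
def IsNormalToContactCurve (κ : ℝ) (φ : Sph → Amb) (q : ℝ → Sph) (v : ℝ → Amb) : Prop :=
  ∀ t, gMet κ (deriv (fun s => φ (q s)) t) (v t) = 0

/-- The contact curve is a line of curvature: its velocity is always a principal vector. -/
def IsLineOfCurvature (φ N : Sph → Amb) (q : ℝ → Sph) : Prop :=
  ∀ t, ∃ r : ℝ, deriv (fun s => N (q s)) t = r • deriv (fun s => φ (q s)) t

/-- On `I`, the curve `t ↦ φ (q t)` is a geodesic of the surface: the tangential part of its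
second derivative vanishes. -/
def IsSurfaceGeodesicOn (κ : ℝ) (φ : Sph → Amb) (I : Set ℝ) (q : ℝ → Sph) : Prop :=
  ∀ t ∈ I, ∀ w, gMet κ (deriv (deriv (fun s => φ (q s))) t) (dSph φ (q t) w) = 0

end

/-! Everything is computed in the moving frame `(x, N, v, w)`, where `w = crossAt κ x N v` is `v`
rotated in the tangent plane of the surface. Differentiating the constraints on a unit tangent field
fixes all components of its derivative except the one along `w` (`fderiv_eq_fibreVel`), so a tangent
vector of the unit tangent bundle is a pair `(u, c)`: a base vector `u` and a vertical number `c`.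
The corresponding velocity in the space of geodesics is `x ∧ X + v ∧ Y` with `X = c w + s N` and `Y
= r w`, where `s = -⟨v, dN u⟩` and `r = -⟨w, dφ u⟩` (`dLine_eq`).

Strict convexity gives `⟨v, dN u⟩ ≠ 0` when `dφ u = v`, so `(c, s, r)` is arbitrary: the tangent
space of the hypersurface consists exactly of the vectors whose `Y` has no `N`-component
(`hypTangent_eq`). There the neutral metric is `s r' + r s'`, which ignores `c`. Hence the
hypersurface is null, and a totally null plane in the tangent space is `r = 0` or `s = 0`. The first
is invariant under the rotation about the geodesic, the second is not; these are the `α`-plane and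
the `β`-plane.

The plane fields are the kernels of `-⟨dx, w⟩` and `⟨dv, N⟩ = -⟨v, dN⟩`. Let `ϖ = ⟨w, dv⟩`. Then `d`
of the first is `ϖ ∧ ⟨v, dx⟩` (`dForm_alphaForm`) and `d` of the second is `⟨w, dN⟩ ∧ ϖ`
(`dForm_betaForm`). The first is contact because `dφ` is injective, the second because convexity
makes `dN` injective.

A curve is `α`-Legendrian when `⟨w, dx⟩ = 0`, so its contact velocity is along `v`. It is
`β`-Legendrian when the contact velocity is conjugate to `v` for the second fundamental form. In a
two-dimensional tangent plane, orthogonal and conjugate to `v` together force a principal vector; a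
principal vector has nonzero eigenvalue by convexity, so for it orthogonal and conjugate are the
same. Finally the Reeb vector of the `α`-form has `x' = -w` and `ϖ = 0`. The first says that `x` has
unit speed and `v` is its rotated velocity; given this, the tangential part of `x''` is `ϖ v`, so
the second is the geodesic equation (`forall_isReebVector_iff`). -/

noncomputable section

/-! ### Bilinear forms and the cross product of the space forms -/

/-- The bilinear form whose unit level set is the space form. -/
def posForm (κ : ℝ) (x y : Amb) : ℝ :=
  x 0 * y 0 + κ * (x 1 * y 1 + x 2 * y 2 + x 3 * y 3)

/-- `gMet` as a continuous bilinear map. -/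
def gMetL (κ : ℝ) : Amb →L[ℝ] Amb →L[ℝ] ℝ :=
  (LinearMap.mk₂ ℝ (gMet κ) (by intros; simp [gMet]; ring) (by intros; simp [gMet]; ring)
    (by intros; simp [gMet]; ring) (by intros; simp [gMet]; ring)).toContinuousBilinearMap

/-- `posForm` as a continuous bilinear map. -/
def posFormL (κ : ℝ) : Amb →L[ℝ] Amb →L[ℝ] ℝ :=
  (LinearMap.mk₂ ℝ (posForm κ) (by intros; simp [posForm]; ring)
    (by intros; simp [posForm]; ring) (by intros; simp [posForm]; ring)
    (by intros; simp [posForm]; ring)).toContinuousBilinearMap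

/-- The wedge product as a continuous bilinear map. -/
def wedgeL : Amb →L[ℝ] Amb →L[ℝ] Biv :=
  (LinearMap.mk₂ ℝ wedge (by intros; ext; simp [wedge]; ring)
    (by intros; ext; simp [wedge]; ring) (by intros; ext; simp [wedge]; ring)
    (by intros; ext; simp [wedge]; ring)).toContinuousBilinearMap

theorem gMetL_apply (κ : ℝ) (x y : Amb) : gMetL κ x y = gMet κ x y := rfl

theorem posFormL_apply (κ : ℝ) (x y : Amb) : posFormL κ x y = posForm κ x y := rfl

theorem wedgeL_apply (x y : Amb) : wedgeL x y = wedge x y := rfl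

theorem gMet_comm (κ : ℝ) (x y : Amb) : gMet κ x y = gMet κ y x := by
  simp only [gMet]; ring

theorem posForm_comm (κ : ℝ) (x y : Amb) : posForm κ x y = posForm κ y x := by
  simp only [posForm]; ring

theorem gMet_add_left (κ : ℝ) (x y z : Amb) : gMet κ (x + y) z = gMet κ x z + gMet κ y z := by
  simp [gMet]; ring

theorem gMet_add_right (κ : ℝ) (x y z : Amb) : gMet κ z (x + y) = gMet κ z x + gMet κ z y := by
  simp [gMet]; ring

theorem gMet_smul_left (κ r : ℝ) (x z : Amb) : gMet κ (r • x) z = r * gMet κ x z := by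
  simp [gMet]; ring

theorem gMet_smul_right (κ r : ℝ) (x z : Amb) : gMet κ z (r • x) = r * gMet κ z x := by
  simp [gMet]; ring

theorem gMet_neg_left (κ : ℝ) (x z : Amb) : gMet κ (-x) z = -gMet κ x z := by
  simp [gMet]; ring

theorem gMet_neg_right (κ : ℝ) (x z : Amb) : gMet κ z (-x) = -gMet κ z x := by
  simp [gMet]; ring

theorem gMet_zero_left (κ : ℝ) (z : Amb) : gMet κ 0 z = 0 := by simp [gMet]

theorem gMet_zero_right (κ : ℝ) (z : Amb) : gMet κ z 0 = 0 := by simp [gMet]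

theorem posForm_add_right (κ : ℝ) (x y z : Amb) :
    posForm κ z (x + y) = posForm κ z x + posForm κ z y := by
  simp [posForm]; ring

theorem posForm_smul_right (κ r : ℝ) (x z : Amb) :
    posForm κ z (r • x) = r * posForm κ z x := by
  simp [posForm]; ring

theorem det_rows_eq (x a b z : Amb) : (Matrix.of ![x, a, b, z]).det =
    -z 0 * (x 1 * (a 2 * b 3 - a 3 * b 2) - x 2 * (a 1 * b 3 - a 3 * b 1)
      + x 3 * (a 1 * b 2 - a 2 * b 1))
    + z 1 * (x 0 * (a 2 * b 3 - a 3 * b 2) - x 2 * (a 0 * b 3 - a 3 * b 0)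
      + x 3 * (a 0 * b 2 - a 2 * b 0))
    - z 2 * (x 0 * (a 1 * b 3 - a 3 * b 1) - x 1 * (a 0 * b 3 - a 3 * b 0)
      + x 3 * (a 0 * b 1 - a 1 * b 0))
    + z 3 * (x 0 * (a 1 * b 2 - a 2 * b 1) - x 1 * (a 0 * b 2 - a 2 * b 0)
      + x 2 * (a 0 * b 1 - a 1 * b 0)) := by
  simp [Matrix.det_succ_row_zero, Fin.sum_univ_succ, Fin.succAbove]
  ring

theorem crossAt_zero (κ : ℝ) (x a b : Amb) : crossAt κ x a b 0 =
    -κ * (x 1 * (a 2 * b 3 - a 3 * b 2) - x 2 * (a 1 * b 3 - a 3 * b 1)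
      + x 3 * (a 1 * b 2 - a 2 * b 1)) := by
  simp only [crossAt, det_rows_eq]; simp; ring

theorem crossAt_one (κ : ℝ) (x a b : Amb) : crossAt κ x a b 1 =
    x 0 * (a 2 * b 3 - a 3 * b 2) - x 2 * (a 0 * b 3 - a 3 * b 0)
      + x 3 * (a 0 * b 2 - a 2 * b 0) := by
  simp only [crossAt, det_rows_eq]; simp

theorem crossAt_two (κ : ℝ) (x a b : Amb) : crossAt κ x a b 2 =
    -(x 0 * (a 1 * b 3 - a 3 * b 1) - x 1 * (a 0 * b 3 - a 3 * b 0)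
      + x 3 * (a 0 * b 1 - a 1 * b 0)) := by
  simp only [crossAt, det_rows_eq]; simp

theorem crossAt_three (κ : ℝ) (x a b : Amb) : crossAt κ x a b 3 =
    x 0 * (a 1 * b 2 - a 2 * b 1) - x 1 * (a 0 * b 2 - a 2 * b 0)
      + x 2 * (a 0 * b 1 - a 1 * b 0) := by
  simp only [crossAt, det_rows_eq]; simp

theorem crossAt_add_smul (κ r s : ℝ) (x a b c : Amb) :
    crossAt κ x a (r • b + s • c) = r • crossAt κ x a b + s • crossAt κ x a c := by
  ext i
  fin_cases i <;>
    simp [crossAt_zero, crossAt_one, crossAt_two, crossAt_three] <;> ring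

theorem crossAt_neg (κ : ℝ) (x a b : Amb) : crossAt κ x a (-b) = -crossAt κ x a b := by
  ext i
  fin_cases i <;>
    simp [crossAt_zero, crossAt_one, crossAt_two, crossAt_three] <;> ring

theorem crossAt_swap (κ : ℝ) (x a b : Amb) : crossAt κ x b a = -crossAt κ x a b := by
  ext i
  fin_cases i <;>
    simp [crossAt_zero, crossAt_one, crossAt_two, crossAt_three] <;> ring

/-- `crossAt` preserves smoothness. -/
theorem ContDiffOn.crossAt {E : Type} [NormedAddCommGroup E] [NormedSpace ℝ E] {O : Set E}
    {n : WithTop ℕ∞} {x a b : E → Amb} (κ : ℝ) (hx : ContDiffOn ℝ n x O)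
    (ha : ContDiffOn ℝ n a O) (hb : ContDiffOn ℝ n b O) :
    ContDiffOn ℝ n (fun y => crossAt κ (x y) (a y) (b y)) O := by
  rw [contDiffOn_pi] at *
  intro i
  fin_cases i <;>
    simp only [Fin.zero_eta, Fin.mk_one, Fin.reduceFinMk, crossAt_zero, crossAt_one, crossAt_two,
      crossAt_three]
  all_goals
    have hx0 := hx 0; have hx1 := hx 1; have hx2 := hx 2; have hx3 := hx 3
    have ha0 := ha 0; have ha1 := ha 1; have ha2 := ha 2; have ha3 := ha 3
    have hb0 := hb 0; have hb1 := hb 1; have hb2 := hb 2; have hb3 := hb 3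
    fun_prop

/-! ### Orthonormal frames -/

/-- A point `x` of the space form of curvature `κ`, with two orthonormal tangent vectors. -/
structure IsFrame (κ : ℝ) (x n v : Amb) : Prop where
  curv : κ = 0 ∨ κ = 1 ∨ κ = -1
  xx : posForm κ x x = 1
  xn : posForm κ x n = 0
  xv : posForm κ x v = 0
  nn : gMet κ n n = 1
  vv : gMet κ v v = 1
  nv : gMet κ n v = 0

/-- On tangent vectors, the two forms are proportional. -/
theorem posForm_eq_of_tangent {κ : ℝ} (hκ : κ = 0 ∨ κ = 1 ∨ κ = -1) {x y : Amb}
    (hx : posForm κ x x = 1) (hy : posForm κ x y = 0) (z : Amb) :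
    posForm κ y z = κ * gMet κ y z := by
  rcases hκ with rfl | rfl | rfl
  · have h0 : x 0 ≠ 0 := by rintro h; simp [posForm, h] at hx
    have : y 0 = 0 := by simpa [posForm, h0] using hy
    simp [posForm, this]
  · simp [posForm, gMet]; ring
  · simp [posForm, gMet]; ring

/-- Cofactor expansion along the last row. The factor `κ` in the zeroth component is cancelled by
`κ² = 1` when `κ = ±1`; for `κ = 0` tangency forces `z 0 = 0`. -/
theorem gMet_crossAt {κ : ℝ} (hκ : κ = 0 ∨ κ = 1 ∨ κ = -1) {x z : Amb}
    (hx : posForm κ x x = 1) (hz : posForm κ x z = 0) (a b : Amb) :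
    gMet κ (crossAt κ x a b) z = (Matrix.of ![x, a, b, z]).det := by
  rw [det_rows_eq, gMet, crossAt_zero, crossAt_one, crossAt_two, crossAt_three]
  rcases hκ with rfl | rfl | rfl
  · have h0 : x 0 ≠ 0 := by rintro h; simp [posForm, h] at hx
    have : z 0 = 0 := by simpa [posForm, h0] using hz
    rw [this]; ring
  · ring
  · ring

theorem posForm_crossAt (κ : ℝ) (x a b : Amb) : posForm κ x (crossAt κ x a b) = 0 := by
  rw [posForm, crossAt_zero, crossAt_one, crossAt_two, crossAt_three]
  ring

namespace IsFrame

variable {κ : ℝ} {x n v : Amb}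

theorem gMet_n_cross (h : IsFrame κ x n v) : gMet κ n (crossAt κ x n v) = 0 := by
  rw [gMet_comm, gMet_crossAt h.curv h.xx h.xn, det_rows_eq]; ring

theorem gMet_v_cross (h : IsFrame κ x n v) : gMet κ v (crossAt κ x n v) = 0 := by
  rw [gMet_comm, gMet_crossAt h.curv h.xx h.xv, det_rows_eq]; ring

theorem gMet_cross_cross (h : IsFrame κ x n v) :
    gMet κ (crossAt κ x n v) (crossAt κ x n v) = 1 := by
  obtain ⟨hκ, xx, xn, xv, nn, vv, nv⟩ := h
  rw [gMet, crossAt_zero, crossAt_one, crossAt_two, crossAt_three]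
  rcases hκ with rfl | rfl | rfl
  · have h0 : x 0 ≠ 0 := by rintro h; simp [posForm, h] at xx
    have hn : n 0 = 0 := by simpa [posForm, h0] using xn
    have hv : v 0 = 0 := by simpa [posForm, h0] using xv
    simp only [posForm, gMet, hn, hv] at *
    -- Lagrange's identity for the Euclidean cross product of `n` and `v`, scaled by `x 0 * x 0 =
    -- 1`.
    have key : (x 0 * x 0) * ((n 1 * n 1 + n 2 * n 2 + n 3 * n 3) *
      (v 1 * v 1 + v 2 * v 2 + v 3 * v 3) - (n 1 * v 1 + n 2 * v 2 + n 3 * v 3) ^ 2) = 1 := by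
      rw [show x 0 * x 0 = 1 by linarith, show n 1 * n 1 + n 2 * n 2 + n 3 * n 3 = 1 by linarith,
        show v 1 * v 1 + v 2 * v 2 + v 3 * v 3 = 1 by linarith,
        show n 1 * v 1 + n 2 * v 2 + n 3 * v 3 = 0 by linarith]
      norm_num
    linear_combination key
  -- The squared norm of a triple cross product is the Gram determinant of `x, n, v`; in the
  -- Lorentzian case below it acquires a minus sign, compensated by `gMet (-1) x x = -1`.
  · have key : gMet 1 x x * (gMet 1 n n * gMet 1 v v - gMet 1 n v ^ 2)
      - gMet 1 x n * (gMet 1 x n * gMet 1 v v - gMet 1 n v * gMet 1 x v)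
      + gMet 1 x v * (gMet 1 x n * gMet 1 n v - gMet 1 n n * gMet 1 x v) = 1 := by
      rw [nn, vv, nv, show gMet 1 x x = posForm 1 x x by simp [gMet, posForm]; ring,
        show gMet 1 x n = posForm 1 x n by simp [gMet, posForm]; ring,
        show gMet 1 x v = posForm 1 x v by simp [gMet, posForm]; ring, xx, xn, xv]
      norm_num
    simp only [gMet] at key
    linear_combination key
  · have key : -gMet (-1) x x * (gMet (-1) n n * gMet (-1) v v - gMet (-1) n v ^ 2)
      + gMet (-1) x n * (gMet (-1) x n * gMet (-1) v v - gMet (-1) n v * gMet (-1) x v)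
      - gMet (-1) x v * (gMet (-1) x n * gMet (-1) n v - gMet (-1) n n * gMet (-1) x v) = 1 := by
      rw [nn, vv, nv, show gMet (-1) x x = -posForm (-1) x x by simp [gMet, posForm]; ring,
        show gMet (-1) x n = -posForm (-1) x n by simp [gMet, posForm]; ring,
        show gMet (-1) x v = -posForm (-1) x v by simp [gMet, posForm]; ring, xx, xn, xv]
      norm_num
    simp only [gMet] at key
    linear_combination key

theorem det_eq_one (h : IsFrame κ x n v) :
    (Matrix.of ![x, n, v, crossAt κ x n v]).det = 1 := by
  rw [← gMet_crossAt h.curv h.xx (posForm_crossAt ..), h.gMet_cross_cross]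

/-- A tangent vector expands in the orthonormal frame. -/
theorem eq_of_tangent (h : IsFrame κ x n v) {y : Amb} (hy : posForm κ x y = 0) :
    y = gMet κ v y • v + gMet κ (crossAt κ x n v) y • crossAt κ x n v + gMet κ n y • n := by
  set w := crossAt κ x n v with hw
  set M : Matrix (Fin 4) (Fin 4) ℝ := Matrix.of ![x, n, v, w] with hM
  -- Determinant one makes the frame a basis, so coefficients of `y` exist; pairing with each frame
  -- vector then identifies them.
  have hu : IsUnit M.det := by rw [hM, h.det_eq_one]; exact isUnit_one
  set c := Matrix.vecMul y M⁻¹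
  have hc : y = c 0 • x + c 1 • n + c 2 • v + c 3 • w := by
    have : Matrix.vecMul c M = y := by
      rw [Matrix.vecMul_vecMul, Matrix.nonsing_inv_mul _ hu, Matrix.vecMul_one]
    rw [← this]
    ext i
    simp [Matrix.vecMul, dotProduct, Fin.sum_univ_four, hM]
  have h0 : c 0 = 0 := by
    rw [hc] at hy
    simpa [posForm_add_right, posForm_smul_right, h.xx, h.xn, h.xv, posForm_crossAt, hw] using hy
  rw [h0, zero_smul, zero_add] at hc
  have h1 : gMet κ n y = c 1 := by
    rw [hc]; simp [gMet_add_right, gMet_smul_right, h.nn, h.nv, h.gMet_n_cross, hw]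
  have h2 : gMet κ v y = c 2 := by
    rw [hc]; simp [gMet_add_right, gMet_smul_right, h.vv, gMet_comm κ v n, h.nv, h.gMet_v_cross, hw]
  have h3 : gMet κ w y = c 3 := by
    rw [hc]; simp [gMet_add_right, gMet_smul_right, gMet_comm κ _ n, gMet_comm κ _ v,
      h.gMet_n_cross, h.gMet_v_cross, h.gMet_cross_cross, hw]
  rw [h1, h2, h3]
  nth_rewrite 1 [hc]
  abel

/-- A vector expands in the frame. -/
theorem eq_add (h : IsFrame κ x n v) {y : Amb} (hy : ∀ z, posForm κ x z = 0 →
    posForm κ x y * gMet κ z x = 0) :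
    y = posForm κ x y • x + (gMet κ v y • v + gMet κ (crossAt κ x n v) y • crossAt κ x n v
      + gMet κ n y • n) := by
  have h1 : posForm κ x (y + (-posForm κ x y) • x) = 0 := by
    rw [posForm_add_right, posForm_smul_right, h.xx]; ring
  have h2 := h.eq_of_tangent h1
  -- For `κ = 0` a tangent vector need not be `gMet`-orthogonal to the position `x`; the hypothesis
  -- `hy` is what removes the correction term.
  have h3 : ∀ z, posForm κ x z = 0 →
      gMet κ z (y + (-posForm κ x y) • x) = gMet κ z y := by
    intro z hz
    rw [gMet_add_right, gMet_smul_right, neg_mul, hy z hz]; ring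
  rw [h3 v h.xv, h3 n h.xn, h3 _ (posForm_crossAt ..)] at h2
  rw [← h2]
  simp

theorem cross_v_cross (h : IsFrame κ x n v) : crossAt κ x v (crossAt κ x n v) = n := by
  rw [h.eq_of_tangent (posForm_crossAt κ x v (crossAt κ x n v)), gMet_comm κ v, gMet_comm κ _
    (crossAt κ x v _), gMet_comm κ n, gMet_crossAt h.curv h.xx h.xv,
    gMet_crossAt h.curv h.xx h.xn, gMet_crossAt h.curv h.xx (posForm_crossAt ..)]
  have h1 : (Matrix.of ![x, v, crossAt κ x n v, n]).det = 1 := by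
    rw [← h.det_eq_one, det_rows_eq, det_rows_eq]; ring
  have h2 : (Matrix.of ![x, v, crossAt κ x n v, v]).det = 0 := by rw [det_rows_eq]; ring
  have h3 : (Matrix.of ![x, v, crossAt κ x n v, crossAt κ x n v]).det = 0 := by
    rw [det_rows_eq]; ring
  rw [h1, h2, h3]; simp

theorem cross_n_cross (h : IsFrame κ x n v) : crossAt κ x n (crossAt κ x n v) = -v := by
  rw [h.eq_of_tangent (posForm_crossAt κ x n (crossAt κ x n v)), gMet_comm κ v, gMet_comm κ _
    (crossAt κ x n (crossAt κ x n v)), gMet_comm κ n, gMet_crossAt h.curv h.xx h.xv,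
    gMet_crossAt h.curv h.xx h.xn, gMet_crossAt h.curv h.xx (posForm_crossAt ..)]
  have h1 : (Matrix.of ![x, n, crossAt κ x n v, v]).det = -1 := by
    rw [← h.det_eq_one, det_rows_eq, det_rows_eq]; ring
  have h2 : (Matrix.of ![x, n, crossAt κ x n v, n]).det = 0 := by rw [det_rows_eq]; ring
  have h3 : (Matrix.of ![x, n, crossAt κ x n v, crossAt κ x n v]).det = 0 := by
    rw [det_rows_eq]; ring
  rw [h1, h2, h3]; simp

/-- The rotation by `90°` of the plane orthogonal to the geodesic. -/
theorem cross_v_normal (h : IsFrame κ x n v) (c s : ℝ) :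
    crossAt κ x v (c • crossAt κ x n v + s • n) = (-s) • crossAt κ x n v + c • n := by
  rw [crossAt_add_smul, h.cross_v_cross, crossAt_swap κ x n v]
  simp [add_comm]

end IsFrame

/-! ### Calculus on the sphere -/

section Calculus

variable {E : Type} [NormedAddCommGroup E] [NormedSpace ℝ E]

/-- The differential of a map to the 2-sphere. -/
def dBase (q : E → Sph) (y : E) : E →L[ℝ] EuclideanSpace ℝ (Fin 2) :=
  mfderiv 𝓘(ℝ, E) (𝓡 2) q y

theorem contDiffOn_sphere_comp {f : Sph → Amb} (hf : ContMDiff (𝓡 2) 𝓘(ℝ, Amb) ∞ f)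
    {O : Set E} {q : E → Sph} (hq : ContMDiffOn 𝓘(ℝ, E) (𝓡 2) ∞ q O) :
    ContDiffOn ℝ ∞ (fun y => f (q y)) O :=
  contMDiffOn_iff_contDiffOn.1 (hf.comp_contMDiffOn hq)

theorem hasFDerivAt_sphere_comp {f : Sph → Amb} (hf : ContMDiff (𝓡 2) 𝓘(ℝ, Amb) ∞ f)
    {O : Set E} (hO : IsOpen O) {q : E → Sph} (hq : ContMDiffOn 𝓘(ℝ, E) (𝓡 2) ∞ q O)
    {y : E} (hy : y ∈ O) :
    HasFDerivAt (fun y => f (q y)) ((dSph f (q y)).comp (dBase q y)) y := by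
  have h1 : MDifferentiableAt 𝓘(ℝ, E) (𝓡 2) q y :=
    (hq.contMDiffAt (hO.mem_nhds hy)).mdifferentiableAt (by simp)
  have h2 : MDifferentiableAt (𝓡 2) 𝓘(ℝ, Amb) f (q y) := hf.mdifferentiableAt (by simp)
  exact (h2.hasMFDerivAt.comp y h1.hasMFDerivAt).hasFDerivAt

theorem fderiv_sphere_comp {f : Sph → Amb} (hf : ContMDiff (𝓡 2) 𝓘(ℝ, Amb) ∞ f)
    {O : Set E} (hO : IsOpen O) {q : E → Sph} (hq : ContMDiffOn 𝓘(ℝ, E) (𝓡 2) ∞ q O)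
    {y : E} (hy : y ∈ O) (a : E) :
    fderiv ℝ (fun y => f (q y)) y a = dSph f (q y) (dBase q y a) := by
  rw [(hasFDerivAt_sphere_comp hf hO hq hy).fderiv]; rfl

/-- The inverse of a chart serves as parametrisation; it reduces differentiation on the sphere to
differentiation on an open subset of a vector space. -/
theorem exists_sphere_param (p : Sph) :
    ∃ (O : Set (EuclideanSpace ℝ (Fin 2))) (q : EuclideanSpace ℝ (Fin 2) → Sph)
      (ξ : EuclideanSpace ℝ (Fin 2)), IsOpen O ∧ ξ ∈ O ∧ q ξ = p ∧
      ContMDiffOn 𝓘(ℝ, EuclideanSpace ℝ (Fin 2)) (𝓡 2) ∞ q O ∧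
      ∀ y ∈ O, Function.Bijective (dBase q y) := by
  refine ⟨(extChartAt (𝓡 2) p).target, (extChartAt (𝓡 2) p).symm, extChartAt (𝓡 2) p p,
    isOpen_extChartAt_target p, mem_extChartAt_target p, extChartAt_to_inv p,
    contMDiffOn_extChartAt_symm p, fun y hy => ?_⟩
  obtain ⟨A, hA⟩ := isInvertible_mfderivWithin_extChartAt_symm hy
  have : ⇑(dBase (extChartAt (𝓡 2) p).symm y) = A := by
    rw [dBase, ← mfderivWithin_univ, ← ModelWithCorners.range_eq_univ (𝓡 2), ← hA]
    rfl
  rw [this]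
  exact A.bijective

/-- The product rule applied to a constant. All the orthogonality relations between derivatives of
the frame come from this. -/
theorem bilin_fderiv_eq_zero {B : Amb →L[ℝ] Amb →L[ℝ] ℝ} {f g : E → Amb} {O : Set E}
    (hO : IsOpen O) (hf : ContDiffOn ℝ ∞ f O) (hg : ContDiffOn ℝ ∞ g O) {k : ℝ}
    (h : ∀ y ∈ O, B (f y) (g y) = k) {y : E} (hy : y ∈ O) (a : E) :
    B (f y) (fderiv ℝ g y a) + B (fderiv ℝ f y a) (g y) = 0 := by
  have hf' := (hf.contDiffAt (hO.mem_nhds hy)).differentiableAt (by simp)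
  have hg' := (hg.contDiffAt (hO.mem_nhds hy)).differentiableAt (by simp)
  have h1 := B.fderiv_of_bilinear hf' hg'
  have h2 : (fun y => B (f y) (g y)) =ᶠ[nhds y] fun _ => k := by
    filter_upwards [hO.mem_nhds hy] with z hz using h z hz
  rw [h2.fderiv_eq, fderiv_fun_const] at h1
  have := congrArg (fun l => l a) h1
  simpa using this.symm

theorem bilin_dSph_eq_zero {B : Amb →L[ℝ] Amb →L[ℝ] ℝ} {f g : Sph → Amb}
    (hf : ContMDiff (𝓡 2) 𝓘(ℝ, Amb) ∞ f) (hg : ContMDiff (𝓡 2) 𝓘(ℝ, Amb) ∞ g) {k : ℝ}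
    (h : ∀ p, B (f p) (g p) = k) (p : Sph) (u : EuclideanSpace ℝ (Fin 2)) :
    B (f p) (dSph g p u) + B (dSph f p u) (g p) = 0 := by
  obtain ⟨O, q, ξ, hO, hξ, rfl, hq, hb⟩ := exists_sphere_param p
  obtain ⟨a, rfl⟩ := (hb ξ hξ).2 u
  rw [← fderiv_sphere_comp hf hO hq hξ, ← fderiv_sphere_comp hg hO hq hξ]
  exact bilin_fderiv_eq_zero hO (contDiffOn_sphere_comp hf hq) (contDiffOn_sphere_comp hg hq)
    (fun y _ => h (q y)) hξ a

end Calculus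

/-! ### Strictly convex spheres and their adapted frames -/

/-- A strictly convex sphere in a space form, with a unit normal field. -/
structure IsConvexSphere (κ : ℝ) (φ N : Sph → Amb) : Prop where
  curv : κ = 0 ∨ κ = 1 ∨ κ = -1
  emb : IsEmbeddedSphere κ φ
  normal : IsUnitNormal κ φ N
  convex : IsStrictlyConvex κ φ N

namespace IsConvexSphere

variable {κ : ℝ} {φ N : Sph → Amb}

theorem posForm_self (h : IsConvexSphere κ φ N) (p : Sph) : posForm κ (φ p) (φ p) = 1 :=
  (h.emb.mem p).1

theorem posForm_normal (h : IsConvexSphere κ φ N) (p : Sph) : posForm κ (φ p) (N p) = 0 :=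
  h.normal.tangent p

theorem posForm_dSph (h : IsConvexSphere κ φ N) (p : Sph) (u : EuclideanSpace ℝ (Fin 2)) :
    posForm κ (φ p) (dSph φ p u) = 0 := by
  have := bilin_dSph_eq_zero (B := posFormL κ) h.emb.smooth h.emb.smooth h.posForm_self p u
  rw [posFormL_apply, posFormL_apply, posForm_comm κ (dSph φ p u)] at this
  linarith

theorem gMet_normal_dNormal (h : IsConvexSphere κ φ N) (p : Sph)
    (u : EuclideanSpace ℝ (Fin 2)) : gMet κ (N p) (dSph N p u) = 0 := by
  have := bilin_dSph_eq_zero (B := gMetL κ) h.normal.smooth h.normal.smooth h.normal.unit p u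
  rw [gMetL_apply, gMetL_apply, gMet_comm κ (dSph N p u)] at this
  linarith

/-- Differentiating `posForm κ (φ p) (N p) = 0` leaves the extra term `posForm κ (dφ u) N`, which is
`κ ⟨dφ u, N⟩ = 0`. -/
theorem posForm_dNormal (h : IsConvexSphere κ φ N) (p : Sph)
    (u : EuclideanSpace ℝ (Fin 2)) : posForm κ (φ p) (dSph N p u) = 0 := by
  have := bilin_dSph_eq_zero (B := posFormL κ) h.emb.smooth h.normal.smooth h.posForm_normal p u
  rwa [posFormL_apply, posFormL_apply,
    posForm_eq_of_tangent h.curv (h.posForm_self p) (h.posForm_dSph p u), gMet_comm,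
    h.normal.normal, mul_zero, add_zero] at this

theorem gMet_dNormal_self_ne (h : IsConvexSphere κ φ N) (p : Sph)
    {u : EuclideanSpace ℝ (Fin 2)} (hu : u ≠ 0) :
    gMet κ (dSph N p u) (dSph φ p u) ≠ 0 := by
  have := h.convex p u hu
  rwa [secondForm, neg_ne_zero] at this

theorem isFrame (h : IsConvexSphere κ φ N) {p : Sph} {v : Amb} (hv : v ∈ unitTangent κ φ p) :
    IsFrame κ (φ p) (N p) v := by
  obtain ⟨⟨u, rfl⟩, hv⟩ := hv
  exact ⟨h.curv, h.posForm_self p, h.posForm_normal p, h.posForm_dSph p u, h.normal.unit p, hv,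
    h.normal.normal p u⟩

/-- A tangent vector of the surface in the frame `(v, v^⊥)`. -/
theorem dSph_eq (h : IsConvexSphere κ φ N) {p : Sph} {v : Amb} (hv : v ∈ unitTangent κ φ p)
    (u : EuclideanSpace ℝ (Fin 2)) :
    dSph φ p u = gMet κ v (dSph φ p u) • v +
      gMet κ (crossAt κ (φ p) (N p) v) (dSph φ p u) • crossAt κ (φ p) (N p) v := by
  have := (h.isFrame hv).eq_of_tangent (h.posForm_dSph p u)
  rwa [h.normal.normal, zero_smul, add_zero] at this

theorem dNormal_eq (h : IsConvexSphere κ φ N) {p : Sph} {v : Amb} (hv : v ∈ unitTangent κ φ p)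
    (u : EuclideanSpace ℝ (Fin 2)) :
    dSph N p u = gMet κ v (dSph N p u) • v +
      gMet κ (crossAt κ (φ p) (N p) v) (dSph N p u) • crossAt κ (φ p) (N p) v := by
  have := (h.isFrame hv).eq_of_tangent (h.posForm_dNormal p u)
  rwa [h.gMet_normal_dNormal, zero_smul, add_zero] at this

/-- The differential of the surface in the frame `(v, v^⊥)` is onto. -/
theorem exists_dSph_coords (h : IsConvexSphere κ φ N) {p : Sph} {v : Amb}
    (hv : v ∈ unitTangent κ φ p) (a b : ℝ) :
    ∃ u, gMet κ v (dSph φ p u) = a ∧ gMet κ (crossAt κ (φ p) (N p) v) (dSph φ p u) = b := by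
  let R : EuclideanSpace ℝ (Fin 2) →ₗ[ℝ] ℝ × ℝ :=
    ((gMetL κ v).comp (dSph φ p)).toLinearMap.prod
      ((gMetL κ (crossAt κ (φ p) (N p) v)).comp (dSph φ p)).toLinearMap
  have hR : Function.Injective R := by
    rw [← LinearMap.ker_eq_bot, LinearMap.ker_eq_bot']
    intro u hu
    obtain ⟨h1, h2⟩ := Prod.mk.inj hu
    apply h.emb.immersion p
    rw [map_zero, h.dSph_eq hv u]
    change gMet κ v (dSph φ p u) = 0 at h1
    change gMet κ (crossAt κ (φ p) (N p) v) (dSph φ p u) = 0 at h2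
    rw [h1, h2]; simp
  obtain ⟨u, hu⟩ := (LinearMap.injective_iff_surjective_of_finrank_eq_finrank (by simp)).1 hR (a, b)
  exact ⟨u, Prod.mk.inj hu⟩

/-- The differential of the normal field in the frame `(v, v^⊥)` is onto. -/
theorem exists_dNormal_coords (h : IsConvexSphere κ φ N) {p : Sph} {v : Amb}
    (hv : v ∈ unitTangent κ φ p) (a b : ℝ) :
    ∃ u, gMet κ v (dSph N p u) = a ∧ gMet κ (crossAt κ (φ p) (N p) v) (dSph N p u) = b := by
  let R : EuclideanSpace ℝ (Fin 2) →ₗ[ℝ] ℝ × ℝ :=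
    ((gMetL κ v).comp (dSph N p)).toLinearMap.prod
      ((gMetL κ (crossAt κ (φ p) (N p) v)).comp (dSph N p)).toLinearMap
  have hR : Function.Injective R := by
    rw [← LinearMap.ker_eq_bot, LinearMap.ker_eq_bot']
    intro u hu
    obtain ⟨h1, h2⟩ := Prod.mk.inj hu
    by_contra hne
    -- A kernel vector of the shape operator would have vanishing normal curvature, against
    -- convexity.
    apply h.gMet_dNormal_self_ne p hne
    rw [h.dNormal_eq hv u]
    change gMet κ v (dSph N p u) = 0 at h1
    change gMet κ (crossAt κ (φ p) (N p) v) (dSph N p u) = 0 at h2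
    rw [h1, h2]; simp [gMet_zero_left]
  obtain ⟨u, hu⟩ := (LinearMap.injective_iff_surjective_of_finrank_eq_finrank (by simp)).1 hR (a, b)
  exact ⟨u, Prod.mk.inj hu⟩

theorem exists_dSph_eq (h : IsConvexSphere κ φ N) {p : Sph} {v : Amb}
    (hv : v ∈ unitTangent κ φ p) (a b : ℝ) :
    ∃ u, dSph φ p u = a • v + b • crossAt κ (φ p) (N p) v := by
  obtain ⟨u, h1, h2⟩ := h.exists_dSph_coords hv a b
  exact ⟨u, by rw [h.dSph_eq hv u, h1, h2]⟩

theorem rotate_mem_unitTangent (h : IsConvexSphere κ φ N) {p : Sph} {v : Amb}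
    (hv : v ∈ unitTangent κ φ p) (θ : ℝ) :
    Real.cos θ • v + Real.sin θ • crossAt κ (φ p) (N p) v ∈ unitTangent κ φ p := by
  refine ⟨h.exists_dSph_eq hv _ _, ?_⟩
  have hf := h.isFrame hv
  simp only [gMet_add_left, gMet_add_right, gMet_smul_left, gMet_smul_right, hf.vv,
    hf.gMet_cross_cross, gMet_comm κ _ v, hf.gMet_v_cross]
  nlinarith [Real.sin_sq_add_cos_sq θ]

/-! ### Velocities of the unit tangent bundle -/

/-- The second component of the tangent vector of the unit tangent bundle with base component
`dφ u` and vertical component `c`. -/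
def fibreVel (κ : ℝ) (φ N : Sph → Amb) (p : Sph) (v : Amb) (u : EuclideanSpace ℝ (Fin 2))
    (c : ℝ) : Amb :=
  (-(κ * gMet κ v (dSph φ p u))) • φ p +
    (c • crossAt κ (φ p) (N p) v + (-gMet κ v (dSph N p u)) • N p)

section Velocity

variable {E : Type} [NormedAddCommGroup E] [NormedSpace ℝ E] {O : Set E} {q : E → Sph}
  {V : E → Amb}

theorem gMet_fderiv_self (hm : IsSmoothMapOn κ φ O q V) {y : E} (hy : y ∈ O)
    (a : E) : gMet κ (V y) (fderiv ℝ V y a) = 0 := by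
  have := bilin_fderiv_eq_zero (B := gMetL κ) hm.isOpen hm.smooth_snd hm.smooth_snd
    (fun y hy => (hm.mem y hy).2) hy a
  rw [gMetL_apply, gMetL_apply, gMet_comm κ (fderiv ℝ V y a)] at this
  linarith

theorem gMet_normal_fderiv (h : IsConvexSphere κ φ N) (hm : IsSmoothMapOn κ φ O q V)
    {y : E} (hy : y ∈ O) (a : E) : gMet κ (N (q y)) (fderiv ℝ V y a) =
      -gMet κ (V y) (dSph N (q y) (dBase q y a)) := by
  have := bilin_fderiv_eq_zero (B := gMetL κ) hm.isOpen
    (contDiffOn_sphere_comp h.normal.smooth hm.smooth_fst) hm.smooth_snd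
    (fun y hy => (h.isFrame (hm.mem y hy)).nv) hy a
  rw [gMetL_apply, gMetL_apply, fderiv_sphere_comp h.normal.smooth hm.isOpen hm.smooth_fst hy,
    gMet_comm κ (dSph N _ _)] at this
  linarith

theorem posForm_fderiv (h : IsConvexSphere κ φ N) (hm : IsSmoothMapOn κ φ O q V)
    {y : E} (hy : y ∈ O) (a : E) : posForm κ (φ (q y)) (fderiv ℝ V y a) =
      -(κ * gMet κ (V y) (dSph φ (q y) (dBase q y a))) := by
  have := bilin_fderiv_eq_zero (B := posFormL κ) hm.isOpen
    (contDiffOn_sphere_comp h.emb.smooth hm.smooth_fst) hm.smooth_snd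
    (fun y hy => (h.isFrame (hm.mem y hy)).xv) hy a
  rw [posFormL_apply, posFormL_apply, fderiv_sphere_comp h.emb.smooth hm.isOpen hm.smooth_fst hy,
    posForm_eq_of_tangent h.curv (h.posForm_self _) (h.posForm_dSph _ _),
    gMet_comm κ (dSph φ _ _)] at this
  linarith

/-- For `κ = ±1` tangent vectors are `gMet`-orthogonal to the position; for `κ = 0` they may not be,
but the factor `κ` kills the product. -/
theorem curv_mul_gMet (h : IsConvexSphere κ φ N) (p : Sph) {z : Amb}
    (hz : posForm κ (φ p) z = 0) : κ * gMet κ z (φ p) = 0 := by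
  rw [← posForm_eq_of_tangent h.curv (h.posForm_self p) hz, posForm_comm, hz]

/-- The constraints `⟨V, V⟩ = 1`, `⟨N, V⟩ = 0` and tangency at `φ` determine the components along
`V`, `N` and `φ`; only the rotation speed along `v^⊥` stays free. -/
theorem fderiv_eq_fibreVel (h : IsConvexSphere κ φ N) (hm : IsSmoothMapOn κ φ O q V)
    {y : E} (hy : y ∈ O) (a : E) : fderiv ℝ V y a = fibreVel κ φ N (q y) (V y) (dBase q y a)
      (gMet κ (crossAt κ (φ (q y)) (N (q y)) (V y)) (fderiv ℝ V y a)) := by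
  have hf := h.isFrame (hm.mem y hy)
  have := hf.eq_add (y := fderiv ℝ V y a) (fun z hz => by
    rw [h.posForm_fderiv hm hy a]
    linear_combination (-gMet κ (V y) (dSph φ (q y) (dBase q y a))) * h.curv_mul_gMet _ hz)
  rwa [gMet_fderiv_self hm hy, h.gMet_normal_fderiv hm hy, h.posForm_fderiv hm hy,
    zero_smul, zero_add] at this

theorem fderiv_pair (h : IsConvexSphere κ φ N) (hm : IsSmoothMapOn κ φ O q V)
    {y : E} (hy : y ∈ O) (a : E) : fderiv ℝ (fun z => (φ (q z), V z)) y a =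
      (dSph φ (q y) (dBase q y a), fderiv ℝ V y a) := by
  have h1 := hasFDerivAt_sphere_comp h.emb.smooth hm.isOpen hm.smooth_fst hy
  have h2 := ((hm.smooth_snd.contDiffAt (hm.isOpen.mem_nhds hy)).differentiableAt
    (by simp)).hasFDerivAt
  rw [(h1.prodMk h2).fderiv]
  rfl

end Velocity

/-- The velocities of a local parametrisation at a point exhaust the tangent vectors. -/
theorem exists_velocity (h : IsConvexSphere κ φ N) {O : Set (EuclideanSpace ℝ (Fin 3))}
    {q : EuclideanSpace ℝ (Fin 3) → Sph} {V : EuclideanSpace ℝ (Fin 3) → Amb}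
    (hP : IsParam κ φ O q V) {y : EuclideanSpace ℝ (Fin 3)} (hy : y ∈ O)
    (u : EuclideanSpace ℝ (Fin 2)) (c : ℝ) :
    ∃ a, dBase q y a = u ∧
      gMet κ (crossAt κ (φ (q y)) (N (q y)) (V y)) (fderiv ℝ V y a) = c := by
  let R : EuclideanSpace ℝ (Fin 3) →ₗ[ℝ] EuclideanSpace ℝ (Fin 2) × ℝ :=
    (dBase q y).toLinearMap.prod
      ((gMetL κ (crossAt κ (φ (q y)) (N (q y)) (V y))).comp (fderiv ℝ V y)).toLinearMap
  -- Base and rotation components determine the whole velocity, so injectivity of the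
  -- parametrisation passes to `R`; surjectivity follows from `3 = 2 + 1`.
  have hR : Function.Injective R := by
    intro a b hab
    obtain ⟨h1, h2⟩ := Prod.mk.inj hab
    change dBase q y a = dBase q y b at h1
    change gMet κ (crossAt κ (φ (q y)) (N (q y)) (V y)) (fderiv ℝ V y a) =
      gMet κ (crossAt κ (φ (q y)) (N (q y)) (V y)) (fderiv ℝ V y b) at h2
    apply hP.2 y hy
    rw [h.fderiv_pair hP.1 hy, h.fderiv_pair hP.1 hy, h.fderiv_eq_fibreVel hP.1 hy a,
      h.fderiv_eq_fibreVel hP.1 hy b, h1, h2]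
  obtain ⟨a, ha⟩ :=
    (LinearMap.injective_iff_surjective_of_finrank_eq_finrank (by simp)).1 hR (u, c)
  exact ⟨a, Prod.mk.inj ha⟩

end IsConvexSphere

/-! ### Local parametrisations and tangent vectors of the unit tangent bundle -/

namespace IsConvexSphere

variable {κ : ℝ} {φ N : Sph → Amb}

/-- A smooth local field of unit tangent vectors with prescribed value, over a local
parametrisation of the sphere. -/
theorem exists_unit_field {p : Sph} {v : Amb} (h : IsConvexSphere κ φ N)
    (hv : v ∈ unitTangent κ φ p) :
    ∃ (O : Set (EuclideanSpace ℝ (Fin 2))) (q : EuclideanSpace ℝ (Fin 2) → Sph)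
      (V : EuclideanSpace ℝ (Fin 2) → Amb) (ξ : EuclideanSpace ℝ (Fin 2)),
      IsSmoothMapOn κ φ O q V ∧ ξ ∈ O ∧ q ξ = p ∧ V ξ = v ∧
      ∀ x ∈ O, Function.Injective (dBase q x) := by
  obtain ⟨O, q, ξ, hO, hξ, rfl, hq, hb⟩ := exists_sphere_param p
  obtain ⟨⟨u, rfl⟩, hu⟩ := hv
  obtain ⟨e, rfl⟩ := (hb ξ hξ).2 u
  -- The coordinate field in the constant direction `e`, where `e` is chosen so that `F ξ = v`; it
  -- is normalised on the open set where its squared length `G` is positive.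
  set F : EuclideanSpace ℝ (Fin 2) → Amb := fun x => fderiv ℝ (fun x => φ (q x)) x e with hF
  have hFs : ContDiffOn ℝ ∞ F O :=
    ((contDiffOn_sphere_comp h.emb.smooth hq).fderiv_of_isOpen hO (by simp)).clm_apply
      contDiffOn_const
  have hFe : ∀ x ∈ O, F x = dSph φ (q x) (dBase q x e) := fun x hx =>
    fderiv_sphere_comp h.emb.smooth hO hq hx e
  set G : EuclideanSpace ℝ (Fin 2) → ℝ := fun x => gMetL κ (F x) (F x) with hG
  have hGs : ContDiffOn ℝ ∞ G O := ((gMetL κ).contDiff.comp_contDiffOn hFs).clm_apply hFs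
  have hGξ : G ξ = 1 := by
    change gMetL κ (F ξ) (F ξ) = 1
    rw [gMetL_apply, hFe ξ hξ, hu]
  have hO' : IsOpen (O ∩ G ⁻¹' Set.Ioi 0) := hGs.continuousOn.isOpen_inter_preimage hO isOpen_Ioi
  refine ⟨O ∩ G ⁻¹' Set.Ioi 0, q, fun x => (√(G x))⁻¹ • F x, ξ,
    ⟨hO', hq.mono Set.inter_subset_left, ?_, ?_⟩, ⟨hξ, ?_⟩, rfl, ?_, fun x hx => (hb x hx.1).1⟩
  · exact (((hGs.mono Set.inter_subset_left).sqrt fun x hx => ne_of_gt hx.2).inv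
      fun x hx => (Real.sqrt_pos.2 hx.2).ne').smul (hFs.mono Set.inter_subset_left)
  · rintro x ⟨hx, hGx⟩
    have hGx' : 0 < G x := hGx
    refine ⟨⟨(√(G x))⁻¹ • dBase q x e, by rw [map_smul, hFe x hx]⟩, ?_⟩
    rw [gMet_smul_left, gMet_smul_right, ← gMetL_apply]
    change (√(G x))⁻¹ * ((√(G x))⁻¹ * G x) = 1
    have := Real.mul_self_sqrt hGx'.le
    have h0 := (Real.sqrt_pos.2 hGx').ne'
    field_simp
    rw [sq, this]
  · change 0 < G ξ
    rw [hGξ]; exact one_pos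
  · simp only [hGξ, Real.sqrt_one, inv_one, one_smul]
    exact hFe ξ hξ

/-- Every point of the unit tangent bundle lies in the image of a local parametrisation. -/
theorem exists_isParam {p : Sph} {v : Amb} (h : IsConvexSphere κ φ N)
    (hv : v ∈ unitTangent κ φ p) :
    ∃ (O : Set (EuclideanSpace ℝ (Fin 3))) (q : EuclideanSpace ℝ (Fin 3) → Sph)
      (V : EuclideanSpace ℝ (Fin 3) → Amb) (y : EuclideanSpace ℝ (Fin 3)),
      IsParam κ φ O q V ∧ y ∈ O ∧ q y = p ∧ V y = v := by
  obtain ⟨O, q, V, ξ, hm, hξ, rfl, rfl, hb⟩ := h.exists_unit_field hv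
  set W : EuclideanSpace ℝ (Fin 2) → Amb := fun x => crossAt κ (φ (q x)) (N (q x)) (V x) with hW
  have hWs : ContDiffOn ℝ ∞ W O := ContDiffOn.crossAt κ
    (contDiffOn_sphere_comp h.emb.smooth hm.smooth_fst)
    (contDiffOn_sphere_comp h.normal.smooth hm.smooth_fst) hm.smooth_snd
  let L : EuclideanSpace ℝ (Fin 3) ≃L[ℝ] EuclideanSpace ℝ (Fin 2) × ℝ :=
    ContinuousLinearEquiv.ofFinrankEq (by simp)
  let L1 : EuclideanSpace ℝ (Fin 3) →L[ℝ] EuclideanSpace ℝ (Fin 2) :=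
    (ContinuousLinearMap.fst ℝ _ _).comp L.toContinuousLinearMap
  let L2 : EuclideanSpace ℝ (Fin 3) →L[ℝ] ℝ :=
    (ContinuousLinearMap.snd ℝ _ _).comp L.toContinuousLinearMap
  have hL : ∀ y, L y = (L1 y, L2 y) := fun y => rfl
  have hmaps : Set.MapsTo L1 (L1 ⁻¹' O) O := fun y hy => hy
  have hOo : IsOpen (L1 ⁻¹' O) := hm.isOpen.preimage L1.continuous
  have hqs : ContMDiffOn 𝓘(ℝ, EuclideanSpace ℝ (Fin 3)) (𝓡 2) ∞ (fun y => q (L1 y))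
      (L1 ⁻¹' O) := hm.smooth_fst.comp L1.contDiff.contMDiff.contMDiffOn hmaps
  -- The third coordinate is the angle by which the unit field `V` is rotated in the tangent plane.
  set U : EuclideanSpace ℝ (Fin 3) → Amb := fun y =>
    Real.cos (L2 y) • V (L1 y) + Real.sin (L2 y) • W (L1 y) with hU
  have hUs : ContDiffOn ℝ ∞ U (L1 ⁻¹' O) :=
    ((Real.contDiff_cos.comp L2.contDiff).contDiffOn.smul
      (hm.smooth_snd.comp L1.contDiff.contDiffOn hmaps)).add
    ((Real.contDiff_sin.comp L2.contDiff).contDiffOn.smul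
      (hWs.comp L1.contDiff.contDiffOn hmaps))
  have hs : IsSmoothMapOn κ φ (L1 ⁻¹' O) (fun y => q (L1 y)) U :=
    ⟨hOo, hqs, hUs, fun y hy => h.rotate_mem_unitTangent (hm.mem _ hy) _⟩
  have hy0 : L (L.symm (ξ, 0)) = (ξ, 0) := L.apply_symm_apply _
  have h1 : L1 (L.symm (ξ, 0)) = ξ := congrArg Prod.fst hy0
  have h2 : L2 (L.symm (ξ, 0)) = 0 := congrArg Prod.snd hy0
  refine ⟨L1 ⁻¹' O, fun y => q (L1 y), U, L.symm (ξ, 0), ⟨hs, fun y hy => ?_⟩, ?_, ?_, ?_⟩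
  · rw [injective_iff_map_eq_zero]
    intro a ha
    rw [h.fderiv_pair hs hy] at ha
    obtain ⟨ha1, ha2⟩ := Prod.mk.inj ha
    have hdq : dBase (fun y => q (L1 y)) y a = dBase q (L1 y) (L1 a) := by
      have hq1 : MDifferentiableAt 𝓘(ℝ, EuclideanSpace ℝ (Fin 2)) (𝓡 2) q (L1 y) :=
        (hm.smooth_fst.contMDiffAt (hm.isOpen.mem_nhds hy)).mdifferentiableAt (by simp)
      have := (hq1.hasMFDerivAt.comp y L1.hasFDerivAt.hasMFDerivAt).mfderiv
      change mfderiv _ _ (q ∘ L1) y a = _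
      rw [this]; rfl
    have hL1 : L1 a = 0 := by
      apply hb (L1 y) hy
      rw [← hdq, map_zero]
      apply h.emb.immersion
      rw [ha1, map_zero]
    -- Since `L1 a = 0`, only the angle varies along the line through `y` in direction `a`.
    -- Comparing this derivative with the explicit one below shows that `L2 a` times `(-sin, cos)`
    -- vanishes.
    have hline : HasDerivAt (fun t : ℝ => U (y + t • a)) (fderiv ℝ U y a) 0 := by
      have hUd := ((hUs.contDiffAt (hOo.mem_nhds hy)).differentiableAt (by simp)).hasFDerivAt
      have hl : HasDerivAt (fun t : ℝ => y + t • a) a 0 := by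
        simpa using ((hasDerivAt_id (0 : ℝ)).smul_const a).const_add y
      have h0 : y + (0 : ℝ) • a = y := by simp
      rw [← h0] at hUd
      have := hUd.comp_hasDerivAt (0 : ℝ) hl
      rwa [h0] at this
    have hangle : HasDerivAt (fun t : ℝ => L2 y + t * L2 a) (L2 a) 0 := by
      simpa using ((hasDerivAt_id (0 : ℝ)).mul_const (L2 a)).const_add (L2 y)
    have hline' : HasDerivAt (fun t : ℝ => U (y + t • a))
        ((-Real.sin (L2 y) * L2 a) • V (L1 y) + (Real.cos (L2 y) * L2 a) • W (L1 y)) 0 := by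
      have : (fun t : ℝ => U (y + t • a)) = fun t => Real.cos (L2 y + t * L2 a) • V (L1 y)
          + Real.sin (L2 y + t * L2 a) • W (L1 y) := by
        ext1 t
        simp only [hU, map_add, map_smul, hL1, smul_zero, add_zero, smul_eq_mul]
      rw [this]
      refine ((hangle.cos.smul_const (V (L1 y))).fun_add
        (hangle.sin.smul_const (W (L1 y)))).congr_deriv ?_
      simp only [zero_mul, add_zero]
    have hzero := hline.unique hline'
    rw [ha2] at hzero
    have hf := h.isFrame (hm.mem (L1 y) hy)
    have e1 : -Real.sin (L2 y) * L2 a = 0 := by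
      have := congrArg (gMet κ (V (L1 y))) hzero
      simpa only [gMet_zero_right, gMet_add_right, gMet_smul_right, hf.vv, hf.gMet_v_cross, hW,
        mul_one, mul_zero, add_zero] using this.symm
    have e2 : Real.cos (L2 y) * L2 a = 0 := by
      have := congrArg (gMet κ (W (L1 y))) hzero
      simpa only [gMet_zero_right, gMet_add_right, gMet_smul_right, hf.gMet_cross_cross,
        gMet_comm κ _ (V (L1 y)), hf.gMet_v_cross, hW,
        mul_one, mul_zero, zero_add] using this.symm
    have hL2 : L2 a = 0 := by
      linear_combination (-Real.sin (L2 y)) * e1 + Real.cos (L2 y) * e2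
        - L2 a * Real.sin_sq_add_cos_sq (L2 y)
    apply L.injective
    rw [hL, hL1, hL2, map_zero]; rfl
  · change L1 _ ∈ O
    rwa [h1]
  · change q (L1 _) = _
    rw [h1]
  · simp only [hU, h1, h2]
    simp

/-- The tangent vectors of the unit tangent bundle. -/
theorem mem_bundleTangent_iff (h : IsConvexSphere κ φ N) {p : Sph} {v : Amb}
    (hv : v ∈ unitTangent κ φ p) {τ : Amb × Amb} :
    τ ∈ bundleTangent κ φ p v ↔ ∃ u c, τ = (dSph φ p u, fibreVel κ φ N p v u c) := by
  constructor
  · rintro ⟨I, q, w, hm, h0, rfl, rfl, h1, h2⟩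
    refine ⟨dBase q 0 1, gMet κ (crossAt κ (φ (q 0)) (N (q 0)) (w 0)) (fderiv ℝ w 0 1), ?_⟩
    rw [← h.fderiv_eq_fibreVel hm h0,
      ← fderiv_sphere_comp h.emb.smooth hm.isOpen hm.smooth_fst h0]
    simp [h1.hasFDerivAt.fderiv, h2.hasFDerivAt.fderiv]
  · rintro ⟨u, c, rfl⟩
    obtain ⟨O, q, V, y, hP, hy, rfl, rfl⟩ := h.exists_isParam hv
    obtain ⟨a, rfl, rfl⟩ := h.exists_velocity hP hy u c
    have h0 : y + (0 : ℝ) • a = y := by simp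
    have hl : HasDerivAt (fun t : ℝ => y + t • a) a 0 := by
      simpa using ((hasDerivAt_id (0 : ℝ)).smul_const a).const_add y
    have hls : ContDiff ℝ ∞ fun t : ℝ => y + t • a := by fun_prop
    have hVd := ((hP.1.smooth_snd.contDiffAt (hP.1.isOpen.mem_nhds hy)).differentiableAt
      (by simp)).hasFDerivAt
    have hφd := hasFDerivAt_sphere_comp h.emb.smooth hP.1.isOpen hP.1.smooth_fst hy
    -- The required curve is the image of a straight line in a local parametrisation.
    refine ⟨(fun t : ℝ => y + t • a) ⁻¹' O, fun t => q (y + t • a), fun t => V (y + t • a),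
      ⟨hP.1.isOpen.preimage hls.continuous, ?_, ?_, ?_⟩, ?_, ?_, ?_, ?_, ?_⟩
    · exact hP.1.smooth_fst.comp hls.contMDiff.contMDiffOn fun t ht => ht
    · exact hP.1.smooth_snd.comp hls.contDiffOn fun t ht => ht
    · exact fun t ht => hP.1.mem _ ht
    · simpa using hy
    · simp
    · simp
    · rw [← h0] at hφd
      have := hφd.comp_hasDerivAt (0 : ℝ) hl
      rwa [h0] at this
    · rw [← h0] at hVd
      have := hVd.comp_hasDerivAt (0 : ℝ) hl
      rw [h0] at this
      rwa [← h.fderiv_eq_fibreVel hP.1 hy]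

end IsConvexSphere

/-! ### Totally null planes -/

/-- Contraction of a bivector with a covector, given by its coefficients. -/
def contract (z : Amb) : Biv →ₗ[ℝ] Amb where
  toFun ξ j := ∑ i, z i * ξ i j
  map_add' a b := by ext j; simp [Fin.sum_univ_four]; ring
  map_smul' r a := by ext j; simp [Fin.sum_univ_four]; ring

theorem contract_wedge (z x y : Amb) :
    contract z (wedge x y) = (∑ i, z i * x i) • y - (∑ i, z i * y i) • x := by
  ext j; simp [contract, wedge, Fin.sum_univ_four]; ring

/-- The coefficients of the covector `posForm κ x`. -/
def posCovec (κ : ℝ) (x : Amb) : Amb := ![x 0, κ * x 1, κ * x 2, κ * x 3]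

/-- The coefficients of the covector `gMet κ x`. -/
def gCovec (κ : ℝ) (x : Amb) : Amb := ![κ * x 0, x 1, x 2, x 3]

theorem sum_posCovec (κ : ℝ) (x y : Amb) : ∑ i, posCovec κ x i * y i = posForm κ x y := by
  simp [posCovec, Fin.sum_univ_four, posForm]; ring

theorem sum_gCovec (κ : ℝ) (x y : Amb) : ∑ i, gCovec κ x i * y i = gMet κ x y := by
  simp [gCovec, Fin.sum_univ_four, gMet]; ring

/-- The tangent vector of the space of geodesics with the given frame components; the
`n`-component of `Y` vanishes. -/
def hypVec (κ : ℝ) (x n v : Amb) (c s r : ℝ) : Biv :=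
  lineTangentVec x v (c • crossAt κ x n v + s • n) (r • crossAt κ x n v)

namespace IsFrame

variable {κ : ℝ} {x n v : Amb}

/-- Contracting the bivector with `posForm κ x` returns `X`; contracting with `gMet κ v` returns `Y`
plus a multiple of `X`, the multiple being `gMet κ v x`, which need not vanish for `κ = 0`. -/
theorem lineTangentVec_inj (h : IsFrame κ x n v) {X Y X' Y' : Amb} (hX : IsNormalTo κ x v X)
    (hY : IsNormalTo κ x v Y) (hX' : IsNormalTo κ x v X') (hY' : IsNormalTo κ x v Y')
    (he : lineTangentVec x v X Y = lineTangentVec x v X' Y') : X = X' ∧ Y = Y' := by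
  have key1 : ∀ {X Y}, IsNormalTo κ x v X → IsNormalTo κ x v Y →
      contract (posCovec κ x) (lineTangentVec x v X Y) = X := by
    intro X Y hX hY
    rw [lineTangentVec, map_add, contract_wedge, contract_wedge]
    simp only [sum_posCovec, h.xx, h.xv, show posForm κ x X = 0 from hX.1,
      show posForm κ x Y = 0 from hY.1]
    simp
  have key2 : ∀ {X Y}, IsNormalTo κ x v X → IsNormalTo κ x v Y →
      contract (gCovec κ v) (lineTangentVec x v X Y) = gMet κ v x • X + Y := by
    intro X Y hX hY
    rw [lineTangentVec, map_add, contract_wedge, contract_wedge]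
    simp only [sum_gCovec, h.vv, hX.2, hY.2]
    simp
  have e1 : X = X' := by rw [← key1 hX hY, he, key1 hX' hY']
  refine ⟨e1, ?_⟩
  have e2 := key2 hX hY
  rw [he, key2 hX' hY', e1] at e2
  exact (add_left_cancel e2).symm

theorem isNormalTo_comb (h : IsFrame κ x n v) (c s : ℝ) :
    IsNormalTo κ x v (c • crossAt κ x n v + s • n) := by
  refine ⟨?_, ?_⟩
  · change posForm κ x _ = 0
    rw [posForm_add_right, posForm_smul_right, posForm_smul_right, posForm_crossAt, h.xn]
    ring
  · rw [gMet_add_right, gMet_smul_right, gMet_smul_right, h.gMet_v_cross, gMet_comm κ v n, h.nv]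
    ring

theorem isNormalTo_smul (h : IsFrame κ x n v) (r : ℝ) :
    IsNormalTo κ x v (r • crossAt κ x n v) := by
  simpa using h.isNormalTo_comb r 0

theorem hypVec_inj (h : IsFrame κ x n v) {c s r c' s' r' : ℝ}
    (he : hypVec κ x n v c s r = hypVec κ x n v c' s' r') : c = c' ∧ s = s' ∧ r = r' := by
  obtain ⟨h1, h2⟩ := h.lineTangentVec_inj (h.isNormalTo_comb c s) (h.isNormalTo_smul r)
    (h.isNormalTo_comb c' s') (h.isNormalTo_smul r') he
  have a1 := congrArg (gMet κ (crossAt κ x n v)) h1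
  have a2 := congrArg (gMet κ n) h1
  have a3 := congrArg (gMet κ (crossAt κ x n v)) h2
  simp only [gMet_add_right, gMet_smul_right, h.gMet_cross_cross, h.nn, gMet_comm κ _ n,
    h.gMet_n_cross, mul_one, mul_zero, add_zero, zero_add] at a1 a2 a3
  exact ⟨a1, a2, a3⟩

/-- The neutral metric in the frame. -/
theorem neutralMetric_comb (h : IsFrame κ x n v) (c s r t c' s' r' t' : ℝ) :
    neutralMetric κ x v (c • crossAt κ x n v + s • n) (r • crossAt κ x n v + t • n)
      (c' • crossAt κ x n v + s' • n) (r' • crossAt κ x n v + t' • n) =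
    s * r' - c * t' + r * s' - t * c' := by
  rw [neutralMetric, h.cross_v_normal, h.cross_v_normal]
  simp only [gMet_add_right, gMet_add_left, gMet_smul_left, gMet_smul_right, h.gMet_cross_cross,
    h.nn, gMet_comm κ _ n, h.gMet_n_cross]
  ring

theorem neutralMetric_hyp (h : IsFrame κ x n v) (c s r c' s' r' : ℝ) :
    neutralMetric κ x v (c • crossAt κ x n v + s • n) (r • crossAt κ x n v)
      (c' • crossAt κ x n v + s' • n) (r' • crossAt κ x n v) = s * r' + r * s' := by
  have := h.neutralMetric_comb c s r 0 c' s' r' 0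
  simp only [zero_smul, add_zero] at this
  rw [this]; ring

end IsFrame

/-- The `α`-plane `{x ∧ X | X ⟂ v}`. -/
def alphaPlane (κ : ℝ) (x n v : Amb) : Submodule ℝ Biv :=
  LinearMap.range (LinearMap.toSpanSingleton ℝ Biv (hypVec κ x n v 1 0 0) |>.coprod
    (LinearMap.toSpanSingleton ℝ Biv (hypVec κ x n v 0 1 0)))

/-- The `β`-plane spanned by `x ∧ v^⊥` and `v ∧ v^⊥`. -/
def betaPlane (κ : ℝ) (x n v : Amb) : Submodule ℝ Biv :=
  LinearMap.range (LinearMap.toSpanSingleton ℝ Biv (hypVec κ x n v 1 0 0) |>.coprod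
    (LinearMap.toSpanSingleton ℝ Biv (hypVec κ x n v 0 0 1)))

theorem hypVec_add_smul (κ : ℝ) (x n v : Amb) (a b c s r c' s' r' : ℝ) :
    a • hypVec κ x n v c s r + b • hypVec κ x n v c' s' r' =
      hypVec κ x n v (a * c + b * c') (a * s + b * s') (a * r + b * r') := by
  ext i j; simp [hypVec, lineTangentVec, wedge]; ring

theorem mem_alphaPlane {κ : ℝ} {x n v : Amb} {ξ : Biv} :
    ξ ∈ alphaPlane κ x n v ↔ ∃ c s, hypVec κ x n v c s 0 = ξ := by
  simp [alphaPlane, LinearMap.mem_range, hypVec_add_smul]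

theorem mem_betaPlane {κ : ℝ} {x n v : Amb} {ξ : Biv} :
    ξ ∈ betaPlane κ x n v ↔ ∃ c r, hypVec κ x n v c 0 r = ξ := by
  simp [betaPlane, LinearMap.mem_range, hypVec_add_smul]

/-- The set of tangent vectors of the form `hypVec`. -/
def hypSpace (κ : ℝ) (x n v : Amb) : Set Biv := {ξ | ∃ c s r, hypVec κ x n v c s r = ξ}

namespace IsFrame

variable {κ : ℝ} {x n v : Amb}

theorem finrank_alphaPlane (h : IsFrame κ x n v) :
    Module.finrank ℝ (alphaPlane κ x n v) = 2 := by
  rw [alphaPlane, LinearMap.finrank_range_of_inj]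
  · simp
  · rintro ⟨a, b⟩ ⟨a', b'⟩ hab
    simp only [LinearMap.coprod_apply, LinearMap.toSpanSingleton_apply, hypVec_add_smul] at hab
    obtain ⟨h1, h2, -⟩ := h.hypVec_inj hab
    simp at h1 h2
    rw [h1, h2]

theorem finrank_betaPlane (h : IsFrame κ x n v) :
    Module.finrank ℝ (betaPlane κ x n v) = 2 := by
  rw [betaPlane, LinearMap.finrank_range_of_inj]
  · simp
  · rintro ⟨a, b⟩ ⟨a', b'⟩ hab
    simp only [LinearMap.coprod_apply, LinearMap.toSpanSingleton_apply, hypVec_add_smul] at hab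
    obtain ⟨h1, -, h2⟩ := h.hypVec_inj hab
    simp at h1 h2
    rw [h1, h2]

theorem hypVec_mem_alphaPlane (h : IsFrame κ x n v) {c s r : ℝ} :
    hypVec κ x n v c s r ∈ alphaPlane κ x n v ↔ r = 0 := by
  rw [mem_alphaPlane]
  constructor
  · rintro ⟨c', s', he⟩
    exact (h.hypVec_inj he).2.2.symm
  · rintro rfl
    exact ⟨c, s, rfl⟩

theorem hypVec_mem_betaPlane (h : IsFrame κ x n v) {c s r : ℝ} :
    hypVec κ x n v c s r ∈ betaPlane κ x n v ↔ s = 0 := by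
  rw [mem_betaPlane]
  constructor
  · rintro ⟨c', r', he⟩
    exact (h.hypVec_inj he).2.1.symm
  · rintro rfl
    exact ⟨c, r, rfl⟩

/-- A vector of `hypSpace` has the frame components of its Jacobi field. -/
theorem of_mem_hypSpace (h : IsFrame κ x n v) {X Y : Amb} (hX : IsNormalTo κ x v X)
    (hY : IsNormalTo κ x v Y) (hm : lineTangentVec x v X Y ∈ hypSpace κ x n v) :
    ∃ c s r, X = c • crossAt κ x n v + s • n ∧ Y = r • crossAt κ x n v ∧
      lineTangentVec x v X Y = hypVec κ x n v c s r := by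
  obtain ⟨c, s, r, he⟩ := hm
  obtain ⟨rfl, rfl⟩ := h.lineTangentVec_inj (h.isNormalTo_comb c s) (h.isNormalTo_smul r) hX hY he
  exact ⟨c, s, r, rfl, rfl, rfl⟩

theorem isTotallyNullPlane (h : IsFrame κ x n v) {P : Submodule ℝ Biv}
    (hP : Module.finrank ℝ P = 2) (hs : (P : Set Biv) ⊆ hypSpace κ x n v)
    (hn : ∀ c s r c' s' r', hypVec κ x n v c s r ∈ P → hypVec κ x n v c' s' r' ∈ P →
      s * r' + r * s' = 0) : IsTotallyNullPlane κ x v P := by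
  refine ⟨hP, fun ξ hξ => ?_, fun X Y X' Y' hX hY hX' hY' h1 h2 => ?_⟩
  · obtain ⟨c, s, r, rfl⟩ := hs hξ
    exact ⟨_, _, h.isNormalTo_comb c s, h.isNormalTo_smul r, rfl⟩
  · obtain ⟨c, s, r, rfl, rfl, -⟩ := h.of_mem_hypSpace hX hY (hs h1)
    obtain ⟨c', s', r', rfl, rfl, -⟩ := h.of_mem_hypSpace hX' hY' (hs h2)
    rw [h.neutralMetric_hyp]
    exact hn _ _ _ _ _ _ h1 h2

theorem alphaPlane_subset (κ : ℝ) (x n v : Amb) :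
    (alphaPlane κ x n v : Set Biv) ⊆ hypSpace κ x n v := by
  intro ξ hξ
  obtain ⟨c, s, rfl⟩ := mem_alphaPlane.1 hξ
  exact ⟨c, s, 0, rfl⟩

theorem betaPlane_subset (κ : ℝ) (x n v : Amb) :
    (betaPlane κ x n v : Set Biv) ⊆ hypSpace κ x n v := by
  intro ξ hξ
  obtain ⟨c, r, rfl⟩ := mem_betaPlane.1 hξ
  exact ⟨c, 0, r, rfl⟩

theorem isAlphaPlane_alphaPlane (h : IsFrame κ x n v) :
    IsAlphaPlane κ x v (alphaPlane κ x n v) := by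
  refine ⟨h.isTotallyNullPlane h.finrank_alphaPlane (alphaPlane_subset κ x n v) ?_, ?_⟩
  · intro c s r c' s' r' h1 h2
    rw [h.hypVec_mem_alphaPlane.1 h1, h.hypVec_mem_alphaPlane.1 h2]; ring
  · intro X Y hX hY hm
    obtain ⟨c, s, r, rfl, rfl, he⟩ := h.of_mem_hypSpace hX hY (alphaPlane_subset κ x n v hm)
    rw [he, h.hypVec_mem_alphaPlane] at hm
    subst hm
    have h0 := h.cross_v_normal 0 0
    simp only [zero_smul, neg_zero, add_zero] at h0
    rw [h.cross_v_normal, zero_smul, h0, mem_alphaPlane]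
    exact ⟨-s, c, by simp [hypVec]⟩

theorem isBetaPlane_betaPlane (h : IsFrame κ x n v) :
    IsBetaPlane κ x v (betaPlane κ x n v) := by
  refine ⟨h.isTotallyNullPlane h.finrank_betaPlane (betaPlane_subset κ x n v) ?_, ?_⟩
  · intro c s r c' s' r' h1 h2
    rw [h.hypVec_mem_betaPlane.1 h1, h.hypVec_mem_betaPlane.1 h2]; ring
  · intro hinv
    -- The test vector `x ∧ v^⊥` lies in the plane but is rotated to `x ∧ n`, which has `s = 1`.
    have := hinv _ _ (h.isNormalTo_comb 1 0) (h.isNormalTo_comb 0 0)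
      (mem_betaPlane.2 ⟨1, 0, by simp [hypVec]⟩)
    rw [h.cross_v_normal, h.cross_v_normal] at this
    have he : lineTangentVec x v ((-0 : ℝ) • crossAt κ x n v + (1 : ℝ) • n)
        ((-0 : ℝ) • crossAt κ x n v + (0 : ℝ) • n) = hypVec κ x n v 0 1 0 := by simp [hypVec]
    rw [he, h.hypVec_mem_betaPlane] at this
    exact one_ne_zero this

/-- A totally null plane in `hypSpace` is the `α`-plane or the `β`-plane. -/
theorem eq_alphaPlane_or_eq_betaPlane (h : IsFrame κ x n v) {P : Submodule ℝ Biv}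
    (hP : IsTotallyNullPlane κ x v P) (hs : (P : Set Biv) ⊆ hypSpace κ x n v) :
    P = alphaPlane κ x n v ∨ P = betaPlane κ x n v := by
  have hn : ∀ c s r c' s' r', hypVec κ x n v c s r ∈ P → hypVec κ x n v c' s' r' ∈ P →
      s * r' + r * s' = 0 := by
    intro c s r c' s' r' h1 h2
    rw [← h.neutralMetric_hyp c s r c' s' r']
    exact hP.null _ _ _ _ (h.isNormalTo_comb c s) (h.isNormalTo_smul r)
      (h.isNormalTo_comb c' s') (h.isNormalTo_smul r') h1 h2
  -- A vector with `s ≠ 0` has `r = 0` by nullity with itself, and nullity with any other vector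
  -- then gives `s * r' = 0`. If there is none, the plane lies in `s = 0`.
  by_cases hc : ∃ c s r, hypVec κ x n v c s r ∈ P ∧ s ≠ 0
  · left
    obtain ⟨c, s, r, hm, hs0⟩ := hc
    have hr : r = 0 := by
      have := hn c s r c s r hm hm
      have : s * r = 0 := by linarith
      exact (mul_eq_zero.1 this).resolve_left hs0
    refine Submodule.eq_of_le_of_finrank_eq (fun ξ hξ => ?_) (hP.finrank_eq.trans
      h.finrank_alphaPlane.symm)
    obtain ⟨c', s', r', rfl⟩ := hs hξ
    have := hn c s r c' s' r' hm hξ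
    rw [hr, zero_mul, add_zero] at this
    exact h.hypVec_mem_alphaPlane.2 ((mul_eq_zero.1 this).resolve_left hs0)
  · right
    push Not at hc
    refine Submodule.eq_of_le_of_finrank_eq (fun ξ hξ => ?_) (hP.finrank_eq.trans
      h.finrank_betaPlane.symm)
    obtain ⟨c', s', r', rfl⟩ := hs hξ
    exact h.hypVec_mem_betaPlane.2 (hc _ _ _ hξ)

theorem isAlphaPlane_iff (h : IsFrame κ x n v) (P : Submodule ℝ Biv) :
    (IsAlphaPlane κ x v P ∧ (P : Set Biv) ⊆ hypSpace κ x n v) ↔ P = alphaPlane κ x n v := by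
  constructor
  · rintro ⟨hP, hs⟩
    rcases h.eq_alphaPlane_or_eq_betaPlane hP.1 hs with rfl | rfl
    · rfl
    · exact absurd hP.2 h.isBetaPlane_betaPlane.2
  · rintro rfl
    exact ⟨h.isAlphaPlane_alphaPlane, alphaPlane_subset ..⟩

theorem isBetaPlane_iff (h : IsFrame κ x n v) (P : Submodule ℝ Biv) :
    (IsBetaPlane κ x v P ∧ (P : Set Biv) ⊆ hypSpace κ x n v) ↔ P = betaPlane κ x n v := by
  constructor
  · rintro ⟨hP, hs⟩
    rcases h.eq_alphaPlane_or_eq_betaPlane hP.1 hs with rfl | rfl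
    · exact absurd h.isAlphaPlane_alphaPlane.2 hP.2
    · rfl
  · rintro rfl
    exact ⟨h.isBetaPlane_betaPlane, betaPlane_subset ..⟩

end IsFrame

/-! ### Tangent spaces of the hypersurface -/

namespace IsConvexSphere

variable {κ : ℝ} {φ N : Sph → Amb}

/-- The velocity of a curve of geodesics in the frame. -/
theorem dLine_eq (h : IsConvexSphere κ φ N) {p : Sph} {v : Amb} (hv : v ∈ unitTangent κ φ p)
    (u : EuclideanSpace ℝ (Fin 2)) (c : ℝ) :
    dLine (φ p) v (dSph φ p u, fibreVel κ φ N p v u c) =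
      hypVec κ (φ p) (N p) v c (-gMet κ v (dSph N p u))
        (-gMet κ (crossAt κ (φ p) (N p) v) (dSph φ p u)) := by
  have hu := h.dSph_eq hv u
  set b := gMet κ (crossAt κ (φ p) (N p) v) (dSph φ p u)
  set s := gMet κ v (dSph N p u)
  set a := gMet κ v (dSph φ p u) with ha
  -- The `v`-component of the base velocity is killed by wedging with `v`, and the `φ p`-component
  -- of the fibre velocity by wedging with `φ p`; the rest is the asserted vector.
  rw [fibreVel, ← ha, hu]
  ext i j
  simp [dLine, hypVec, lineTangentVec, wedge]
  ring

/-- The inclusion of the full space is where convexity enters: every pair `(s, r)` must be attained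
by some base vector. -/
theorem hypTangent_eq (h : IsConvexSphere κ φ N) {p : Sph} {v : Amb}
    (hv : v ∈ unitTangent κ φ p) : hypTangent κ φ p v = hypSpace κ (φ p) (N p) v := by
  ext ξ
  constructor
  · rintro ⟨τ, hτ, rfl⟩
    obtain ⟨u, c, rfl⟩ := (h.mem_bundleTangent_iff hv).1 hτ
    exact ⟨_, _, _, (h.dLine_eq hv u c).symm⟩
  · rintro ⟨c, s, r, rfl⟩
    obtain ⟨u₁, hu₁⟩ := h.exists_dSph_eq hv 1 0
    obtain ⟨u₂, hu₂⟩ := h.exists_dSph_eq hv 0 1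
    rw [one_smul, zero_smul, add_zero] at hu₁
    rw [one_smul, zero_smul, zero_add] at hu₂
    have hf := h.isFrame hv
    have h₁ : gMet κ v (dSph N p u₁) ≠ 0 := by
      have hne : u₁ ≠ 0 := by
        rintro rfl
        have := hf.vv
        rw [← hu₁, map_zero, gMet_zero_left] at this
        exact zero_ne_one this
      have := h.gMet_dNormal_self_ne p hne
      rwa [hu₁, gMet_comm] at this
    set k := gMet κ v (dSph N p u₁)
    set m := gMet κ v (dSph N p u₂) with hm
    -- The system for the base vector is triangular: `r` fixes the coefficient of `u₂`, and `s` then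
    -- fixes that of `u₁` after division by `k`, nonzero by convexity.
    have hu : dSph φ p (((m * r - s) / k) • u₁ - r • u₂) =
        ((m * r - s) / k) • v + (-r) • crossAt κ (φ p) (N p) v := by
      rw [map_sub, map_smul, map_smul, hu₁, hu₂, neg_smul, sub_eq_add_neg]
    refine ⟨_, (h.mem_bundleTangent_iff hv).2
      ⟨((m * r - s) / k) • u₁ - r • u₂, c, rfl⟩, ?_⟩
    rw [h.dLine_eq hv, hu]
    congr 1
    · rw [map_sub, map_smul, map_smul, sub_eq_add_neg, ← neg_smul, gMet_add_right,
        gMet_smul_right, gMet_smul_right, ← hm]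
      change -((m * r - s) / k * k + -r * m) = s
      field_simp
      ring
    · rw [gMet_add_right, gMet_smul_right, gMet_smul_right, hf.gMet_cross_cross, gMet_comm κ _ v,
        hf.gMet_v_cross]
      ring

/-- The degenerate direction is `x ∧ v^⊥`, that is, rotation of `v` in the tangent plane with the
base point fixed. -/
theorem isNullAt (h : IsConvexSphere κ φ N) {p : Sph} {v : Amb} (hv : v ∈ unitTangent κ φ p) :
    IsNullAt κ φ p v := by
  have hf := h.isFrame hv
  refine ⟨_, _, hf.isNormalTo_comb 1 0, hf.isNormalTo_smul 0, ?_, ?_, ?_⟩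
  · intro h0
    have : hypVec κ (φ p) (N p) v 1 0 0 = hypVec κ (φ p) (N p) v 0 0 0 := by
      change lineTangentVec _ _ _ _ = _
      rw [h0]; ext; simp [hypVec, lineTangentVec, wedge]
    exact one_ne_zero (hf.hypVec_inj this).1
  · rw [h.hypTangent_eq hv]
    exact ⟨1, 0, 0, rfl⟩
  · intro X Y hX hY hm
    rw [h.hypTangent_eq hv] at hm
    obtain ⟨c, s, r, rfl, rfl, -⟩ := hf.of_mem_hypSpace hX hY hm
    rw [hf.neutralMetric_hyp]; ring

end IsConvexSphere

/-! ### Contact forms -/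

theorem contDiffOn_of_eq_gMet {κ : ℝ} {O : Set (EuclideanSpace ℝ (Fin 3))} (hO : IsOpen O)
    {F W : EuclideanSpace ℝ (Fin 3) → Amb} (hF : ContDiffOn ℝ ∞ F O) (hW : ContDiffOn ℝ ∞ W O)
    {θ : EuclideanSpace ℝ (Fin 3) → EuclideanSpace ℝ (Fin 3) →L[ℝ] ℝ}
    (hθ : ∀ z ∈ O, ∀ b, θ z b = gMet κ (W z) (fderiv ℝ F z b)) : ContDiffOn ℝ ∞ θ O := by
  have : ContDiffOn ℝ ∞ (fun z => (gMetL κ (W z)).comp (fderiv ℝ F z)) O :=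
    ((gMetL κ).contDiff.comp_contDiffOn hW).clm_comp (hF.fderiv_of_isOpen hO (by simp))
  exact this.congr fun z hz => ContinuousLinearMap.ext fun b => hθ z hz b

/-- The exterior derivative of the 1-form `⟨W, dF⟩`. -/
theorem dForm_of_eq_gMet {κ : ℝ} {O : Set (EuclideanSpace ℝ (Fin 3))} (hO : IsOpen O)
    {F W : EuclideanSpace ℝ (Fin 3) → Amb} (hF : ContDiffOn ℝ ∞ F O) (hW : ContDiffOn ℝ ∞ W O)
    {θ : EuclideanSpace ℝ (Fin 3) → EuclideanSpace ℝ (Fin 3) →L[ℝ] ℝ}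
    (hθ : ∀ z ∈ O, ∀ b, θ z b = gMet κ (W z) (fderiv ℝ F z b)) {y : EuclideanSpace ℝ (Fin 3)}
    (hy : y ∈ O) (a b : EuclideanSpace ℝ (Fin 3)) :
    dForm θ y a b = gMet κ (fderiv ℝ W y a) (fderiv ℝ F y b)
      - gMet κ (fderiv ℝ W y b) (fderiv ℝ F y a) := by
  have hFy : ContDiffAt ℝ ∞ F y := hF.contDiffAt (hO.mem_nhds hy)
  -- Symmetry of the second derivative of `F` cancels the terms `⟨W, d²F⟩`, leaving only `dW`.
  have hsymm : IsSymmSndFDerivAt ℝ F y := hFy.isSymmSndFDerivAt (by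
    rw [minSmoothness_of_isRCLikeNormedField]; exact WithTop.coe_le_coe.2 (le_top : (2 : ℕ∞) ≤ ⊤))
  have hF2 : DifferentiableAt ℝ (fderiv ℝ F) y :=
    ((hF.fderiv_of_isOpen (m := ∞) hO (by simp)).contDiffAt (hO.mem_nhds hy)).differentiableAt
      (by simp)
  have hWy : DifferentiableAt ℝ W y := (hW.contDiffAt (hO.mem_nhds hy)).differentiableAt (by simp)
  have he : θ =ᶠ[nhds y] fun z => (gMetL κ (W z)).comp (fderiv ℝ F z) := by
    filter_upwards [hO.mem_nhds hy] with z hz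
    exact ContinuousLinearMap.ext fun b => hθ z hz b
  have hd := (((gMetL κ).hasFDerivAt.comp y hWy.hasFDerivAt).clm_comp hF2.hasFDerivAt)
  have hd' : ∀ a b, fderiv ℝ θ y a b = gMet κ (W y) (fderiv ℝ (fderiv ℝ F) y a b) +
      gMet κ (fderiv ℝ W y a) (fderiv ℝ F y b) := by
    intro a b
    rw [he.fderiv_eq]
    change fderiv ℝ (fun z => ((gMetL κ ∘ W) z).comp (fderiv ℝ F z)) y a b = _
    rw [hd.fderiv]
    rfl
  rw [dForm, hd', hd', hsymm a b]
  ring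

namespace IsConvexSphere

variable {κ : ℝ} {φ N : Sph → Amb}

section Velocity

variable {E : Type} [NormedAddCommGroup E] [NormedSpace ℝ E] {O : Set E} {q : E → Sph}
  {V : E → Amb}

theorem contDiffOn_cross (h : IsConvexSphere κ φ N) (hm : IsSmoothMapOn κ φ O q V) :
    ContDiffOn ℝ ∞ (fun z => crossAt κ (φ (q z)) (N (q z)) (V z)) O :=
  ContDiffOn.crossAt κ (contDiffOn_sphere_comp h.emb.smooth hm.smooth_fst)
    (contDiffOn_sphere_comp h.normal.smooth hm.smooth_fst) hm.smooth_snd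

/-- The rotation of `v^⊥` in the tangent plane. -/
theorem gMet_fderiv_cross (h : IsConvexSphere κ φ N) (hm : IsSmoothMapOn κ φ O q V)
    {y : E} (hy : y ∈ O) (a : E) (u : EuclideanSpace ℝ (Fin 2)) :
    gMet κ (fderiv ℝ (fun z => crossAt κ (φ (q z)) (N (q z)) (V z)) y a) (dSph φ (q y) u) =
      -(gMet κ (V y) (dSph φ (q y) u) *
        gMet κ (crossAt κ (φ (q y)) (N (q y)) (V y)) (fderiv ℝ V y a)) := by
  have hW := h.contDiffOn_cross hm
  -- With `w = v^⊥`, `⟨w, v⟩ = 0` gives `⟨w', v⟩ = -⟨w, v'⟩`, and `⟨w, w⟩ = 1` gives `⟨w', w⟩ = 0`.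
  have h1 := bilin_fderiv_eq_zero (B := gMetL κ) hm.isOpen hW hm.smooth_snd (k := 0)
    (fun y hy => by
      rw [gMetL_apply, gMet_comm]; exact (h.isFrame (hm.mem y hy)).gMet_v_cross) hy a
  have h2 := bilin_fderiv_eq_zero (B := gMetL κ) hm.isOpen hW hW
    (fun y hy => (h.isFrame (hm.mem y hy)).gMet_cross_cross) hy a
  simp only [gMetL_apply] at h1 h2
  rw [gMet_comm] at h2
  rw [h.dSph_eq (hm.mem y hy) u]
  have hf := h.isFrame (hm.mem y hy)
  simp only [gMet_add_right, gMet_smul_right, hf.vv, hf.gMet_v_cross]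
  linear_combination gMet κ (V y) (dSph φ (q y) u) * h1 +
    gMet κ (crossAt κ (φ (q y)) (N (q y)) (V y)) (dSph φ (q y) u) / 2 * h2

end Velocity

theorem gMet_normal_fibreVel (h : IsConvexSphere κ φ N) {p : Sph} {v : Amb}
    (hv : v ∈ unitTangent κ φ p) (u : EuclideanSpace ℝ (Fin 2)) (c : ℝ) :
    gMet κ (N p) (fibreVel κ φ N p v u c) = -gMet κ v (dSph N p u) := by
  have hf := h.isFrame hv
  rw [fibreVel]
  simp only [gMet_add_right, gMet_smul_right, hf.nn, hf.gMet_n_cross]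
  linear_combination (-gMet κ v (dSph φ p u)) * h.curv_mul_gMet p hf.xn

theorem gMet_cross_fibreVel (h : IsConvexSphere κ φ N) {p : Sph} {v : Amb}
    (hv : v ∈ unitTangent κ φ p) (u : EuclideanSpace ℝ (Fin 2)) (c : ℝ) :
    gMet κ (crossAt κ (φ p) (N p) v) (fibreVel κ φ N p v u c) = c := by
  have hf := h.isFrame hv
  rw [fibreVel]
  simp only [gMet_add_right, gMet_smul_right, hf.gMet_cross_cross, gMet_comm κ _ (N p),
    hf.gMet_n_cross]
  linear_combination (-gMet κ v (dSph φ p u)) * h.curv_mul_gMet p (posForm_crossAt κ _ (N p) v)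

theorem alphaForm_apply (κ : ℝ) (φ N : Sph → Amb) (p : Sph) (v : Amb) (τ : Amb × Amb) :
    alphaForm κ φ N p v τ = -gMet κ (crossAt κ (φ p) (N p) v) τ.1 := by
  rw [gMet_comm]; rfl

/-- The 1-form `(x', v') ↦ ⟨v', N⟩`, whose kernel is the field of `β`-planes. -/
def betaForm (κ : ℝ) (N : Sph → Amb) : FormField := fun p _ =>
  (gMetL κ (N p)).comp (ContinuousLinearMap.snd ℝ Amb Amb)

theorem betaForm_apply (κ : ℝ) (N : Sph → Amb) (p : Sph) (v : Amb) (τ : Amb × Amb) :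
    betaForm κ N p v τ = gMet κ (N p) τ.2 := rfl

theorem isDefiningForm_alphaForm (h : IsConvexSphere κ φ N) :
    IsDefiningForm κ φ (fun p v => alphaPlane κ (φ p) (N p) v) (alphaForm κ φ N) := by
  intro p v hv τ hτ
  obtain ⟨u, c, rfl⟩ := (h.mem_bundleTangent_iff hv).1 hτ
  rw [h.dLine_eq hv, (h.isFrame hv).hypVec_mem_alphaPlane, alphaForm_apply]

theorem isDefiningForm_betaForm (h : IsConvexSphere κ φ N) :
    IsDefiningForm κ φ (fun p v => betaPlane κ (φ p) (N p) v) (betaForm κ N) := by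
  intro p v hv τ hτ
  obtain ⟨u, c, rfl⟩ := (h.mem_bundleTangent_iff hv).1 hτ
  rw [h.dLine_eq hv, (h.isFrame hv).hypVec_mem_betaPlane, betaForm_apply,
    h.gMet_normal_fibreVel hv]

section Param

variable {O : Set (EuclideanSpace ℝ (Fin 3))} {q : EuclideanSpace ℝ (Fin 3) → Sph}
  {V : EuclideanSpace ℝ (Fin 3) → Amb}

theorem pullForm_alphaForm (h : IsConvexSphere κ φ N) (hm : IsSmoothMapOn κ φ O q V)
    {y : EuclideanSpace ℝ (Fin 3)} (hy : y ∈ O) (a : EuclideanSpace ℝ (Fin 3)) :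
    pullForm φ (alphaForm κ φ N) q V y a =
      -gMet κ (crossAt κ (φ (q y)) (N (q y)) (V y)) (dSph φ (q y) (dBase q y a)) := by
  change alphaForm κ φ N (q y) (V y) (fderiv ℝ (fun z => (φ (q z), V z)) y a) = _
  rw [alphaForm_apply, h.fderiv_pair hm hy]

theorem pullForm_betaForm (h : IsConvexSphere κ φ N) (hm : IsSmoothMapOn κ φ O q V)
    {y : EuclideanSpace ℝ (Fin 3)} (hy : y ∈ O) (a : EuclideanSpace ℝ (Fin 3)) :
    pullForm φ (betaForm κ N) q V y a = gMet κ (N (q y)) (fderiv ℝ V y a) := by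
  change betaForm κ N (q y) (V y) (fderiv ℝ (fun z => (φ (q z), V z)) y a) = _
  rw [betaForm_apply, h.fderiv_pair hm hy]

theorem pullForm_alphaForm_eq_gMet (h : IsConvexSphere κ φ N) (hm : IsSmoothMapOn κ φ O q V)
    {y : EuclideanSpace ℝ (Fin 3)} (hy : y ∈ O) (a : EuclideanSpace ℝ (Fin 3)) :
    pullForm φ (alphaForm κ φ N) q V y a =
      gMet κ (-crossAt κ (φ (q y)) (N (q y)) (V y)) (fderiv ℝ (fun z => φ (q z)) y a) := by
  rw [h.pullForm_alphaForm hm hy, fderiv_sphere_comp h.emb.smooth hm.isOpen hm.smooth_fst hy,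
    gMet_neg_left]

theorem dForm_alphaForm (h : IsConvexSphere κ φ N) (hm : IsSmoothMapOn κ φ O q V)
    {y : EuclideanSpace ℝ (Fin 3)} (hy : y ∈ O) (a b : EuclideanSpace ℝ (Fin 3)) :
    dForm (pullForm φ (alphaForm κ φ N) q V) y a b =
      gMet κ (V y) (dSph φ (q y) (dBase q y b)) *
        gMet κ (crossAt κ (φ (q y)) (N (q y)) (V y)) (fderiv ℝ V y a) -
      gMet κ (V y) (dSph φ (q y) (dBase q y a)) *
        gMet κ (crossAt κ (φ (q y)) (N (q y)) (V y)) (fderiv ℝ V y b) := by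
  rw [dForm_of_eq_gMet hm.isOpen (contDiffOn_sphere_comp h.emb.smooth hm.smooth_fst)
    (h.contDiffOn_cross hm).neg (fun z hz b => h.pullForm_alphaForm_eq_gMet hm hz b) hy,
    fderiv_fun_neg, fderiv_sphere_comp h.emb.smooth hm.isOpen hm.smooth_fst hy,
    fderiv_sphere_comp h.emb.smooth hm.isOpen hm.smooth_fst hy, neg_apply,
    neg_apply, gMet_neg_left, gMet_neg_left, h.gMet_fderiv_cross hm hy,
    h.gMet_fderiv_cross hm hy]
  ring

theorem dForm_betaForm (h : IsConvexSphere κ φ N) (hm : IsSmoothMapOn κ φ O q V)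
    {y : EuclideanSpace ℝ (Fin 3)} (hy : y ∈ O) (a b : EuclideanSpace ℝ (Fin 3)) :
    dForm (pullForm φ (betaForm κ N) q V) y a b =
      gMet κ (crossAt κ (φ (q y)) (N (q y)) (V y)) (dSph N (q y) (dBase q y a)) *
        gMet κ (crossAt κ (φ (q y)) (N (q y)) (V y)) (fderiv ℝ V y b) -
      gMet κ (crossAt κ (φ (q y)) (N (q y)) (V y)) (dSph N (q y) (dBase q y b)) *
        gMet κ (crossAt κ (φ (q y)) (N (q y)) (V y)) (fderiv ℝ V y a) := by
  have key : ∀ a b, gMet κ (dSph N (q y) (dBase q y a)) (fderiv ℝ V y b) =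
      gMet κ (crossAt κ (φ (q y)) (N (q y)) (V y)) (dSph N (q y) (dBase q y a)) *
        gMet κ (crossAt κ (φ (q y)) (N (q y)) (V y)) (fderiv ℝ V y b) := by
    intro a b
    nth_rewrite 1 [h.dNormal_eq (hm.mem y hy) (dBase q y a)]
    rw [gMet_add_left, gMet_smul_left, gMet_smul_left, gMet_fderiv_self hm hy]
    ring
  rw [dForm_of_eq_gMet hm.isOpen hm.smooth_snd
    (contDiffOn_sphere_comp h.normal.smooth hm.smooth_fst)
    (fun z hz b => h.pullForm_betaForm hm hz b) hy,
    fderiv_sphere_comp h.normal.smooth hm.isOpen hm.smooth_fst hy,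
    fderiv_sphere_comp h.normal.smooth hm.isOpen hm.smooth_fst hy, key, key]

end Param

theorem isContactForm_alphaForm (h : IsConvexSphere κ φ N) :
    IsContactForm κ φ (alphaForm κ φ N) := by
  intro O q V hP
  refine ⟨contDiffOn_of_eq_gMet hP.1.isOpen
    (contDiffOn_sphere_comp h.emb.smooth hP.1.smooth_fst) (h.contDiffOn_cross hP.1).neg
    fun z hz b => h.pullForm_alphaForm_eq_gMet hP.1 hz b, fun y hy => ?_⟩
  have hv := hP.1.mem y hy
  -- Test vectors: bases `v^⊥` and `v` without rotation, and the pure rotation. The form is nonzero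
  -- only on the first, and its differential pairs the other two.
  obtain ⟨u₁, hu₁, hu₁'⟩ := h.exists_dSph_coords hv 0 1
  obtain ⟨u₂, hu₂, hu₂'⟩ := h.exists_dSph_coords hv 1 0
  obtain ⟨a, rfl, ha⟩ := h.exists_velocity hP hy u₁ 0
  obtain ⟨b, rfl, hb⟩ := h.exists_velocity hP hy u₂ 0
  obtain ⟨c, hc0, hc⟩ := h.exists_velocity hP hy 0 1
  refine ⟨a, b, c, ?_⟩
  simp only [wedgeDForm, h.dForm_alphaForm hP.1 hy, h.pullForm_alphaForm hP.1 hy, hu₁, hu₁', hu₂,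
    hu₂', hc0, ha, hb, hc, map_zero, gMet_zero_right]
  norm_num

theorem isContactForm_betaForm (h : IsConvexSphere κ φ N) :
    IsContactForm κ φ (betaForm κ N) := by
  intro O q V hP
  refine ⟨contDiffOn_of_eq_gMet hP.1.isOpen hP.1.smooth_snd
    (contDiffOn_sphere_comp h.normal.smooth hP.1.smooth_fst)
    fun z hz b => h.pullForm_betaForm hP.1 hz b, fun y hy => ?_⟩
  have hv := hP.1.mem y hy
  -- Here the base vectors are prescribed through their images under `dN`, which is possible by
  -- convexity.
  obtain ⟨u₁, hu₁, hu₁'⟩ := h.exists_dNormal_coords hv 1 0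
  obtain ⟨u₂, hu₂, hu₂'⟩ := h.exists_dNormal_coords hv 0 1
  obtain ⟨a, rfl, ha⟩ := h.exists_velocity hP hy u₁ 0
  obtain ⟨b, rfl, hb⟩ := h.exists_velocity hP hy u₂ 0
  obtain ⟨c, hc0, hc⟩ := h.exists_velocity hP hy 0 1
  refine ⟨a, b, c, ?_⟩
  simp only [wedgeDForm, h.dForm_betaForm hP.1 hy, h.pullForm_betaForm hP.1 hy,
    h.gMet_normal_fderiv hP.1 hy, hu₁, hu₁', hu₂,
    hu₂', hc0, ha, hb, hc, map_zero, gMet_zero_right]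
  norm_num

/-! ### Legendrian curves -/

section Curve

variable {I : Set ℝ} {q : ℝ → Sph} {V : ℝ → Amb}

theorem deriv_sphere_comp {f : Sph → Amb} (hf : ContMDiff (𝓡 2) 𝓘(ℝ, Amb) ∞ f)
    (hm : IsSmoothMapOn κ φ I q V) {t : ℝ} (ht : t ∈ I) :
    deriv (fun s => f (q s)) t = dSph f (q t) (dBase q t 1) := by
  rw [← fderiv_sphere_comp hf hm.isOpen hm.smooth_fst ht, fderiv_apply_one_eq_deriv]

theorem deriv_wedge (h : IsConvexSphere κ φ N) (hm : IsSmoothMapOn κ φ I q V) {t : ℝ}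
    (ht : t ∈ I) : deriv (fun s => wedge (φ (q s)) (V s)) t =
      hypVec κ (φ (q t)) (N (q t)) (V t)
        (gMet κ (crossAt κ (φ (q t)) (N (q t)) (V t)) (fderiv ℝ V t 1))
        (-gMet κ (V t) (dSph N (q t) (dBase q t 1)))
        (-gMet κ (crossAt κ (φ (q t)) (N (q t)) (V t)) (dSph φ (q t) (dBase q t 1))) := by
  have h1 : HasDerivAt (fun s => φ (q s)) (dSph φ (q t) (dBase q t 1)) t :=
    (hasFDerivAt_sphere_comp h.emb.smooth hm.isOpen hm.smooth_fst ht).hasDerivAt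
  have h2 : HasDerivAt V (fderiv ℝ V t 1) t :=
    ((hm.smooth_snd.contDiffAt (hm.isOpen.mem_nhds ht)).differentiableAt
      (by simp)).hasFDerivAt.hasDerivAt
  rw [← h.dLine_eq (hm.mem t ht), ← h.fderiv_eq_fibreVel hm ht]
  have := (wedgeL.hasFDerivAt_of_bilinear h1.hasFDerivAt h2.hasFDerivAt).hasDerivAt.deriv
  simp only [wedgeL_apply] at this
  rw [this, dLine, add_comm]
  simp [wedgeL_apply]

theorem deriv_wedge_mem_alphaPlane (h : IsConvexSphere κ φ N) (hm : IsSmoothMapOn κ φ I q V)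
    {t : ℝ} (ht : t ∈ I) :
    deriv (fun s => wedge (φ (q s)) (V s)) t ∈ alphaPlane κ (φ (q t)) (N (q t)) (V t) ↔
      ∃ r : ℝ, deriv (fun s => φ (q s)) t = r • V t := by
  have hf := h.isFrame (hm.mem t ht)
  rw [h.deriv_wedge hm ht, hf.hypVec_mem_alphaPlane, neg_eq_zero,
    deriv_sphere_comp h.emb.smooth hm ht]
  constructor
  · intro h0
    have hu := h.dSph_eq (hm.mem t ht) (dBase q t 1)
    rw [h0, zero_smul, add_zero] at hu
    exact ⟨_, hu⟩
  · rintro ⟨r, hr⟩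
    rw [hr, gMet_smul_right, gMet_comm, hf.gMet_v_cross, mul_zero]

/-- The condition says that the contact velocity is conjugate to `v` for the second fundamental
form. -/
theorem deriv_wedge_mem_betaPlane (h : IsConvexSphere κ φ N) (hm : IsSmoothMapOn κ φ I q V)
    {t : ℝ} (ht : t ∈ I) :
    deriv (fun s => wedge (φ (q s)) (V s)) t ∈ betaPlane κ (φ (q t)) (N (q t)) (V t) ↔
      gMet κ (V t) (dSph N (q t) (dBase q t 1)) = 0 := by
  rw [h.deriv_wedge hm ht, (h.isFrame (hm.mem t ht)).hypVec_mem_betaPlane, neg_eq_zero]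

end Curve

/-- If `u` is orthogonal to `v` for the metric and for the second fundamental form, then it is
a principal vector. -/
theorem exists_dNormal_eq_smul (h : IsConvexSphere κ φ N) {p : Sph} {v : Amb}
    (hv : v ∈ unitTangent κ φ p) {u : EuclideanSpace ℝ (Fin 2)}
    (h1 : gMet κ v (dSph N p u) = 0) (h2 : gMet κ (dSph φ p u) v = 0) :
    ∃ r : ℝ, dSph N p u = r • dSph φ p u := by
  rw [gMet_comm] at h2
  have e1 := h.dNormal_eq hv u
  have e2 := h.dSph_eq hv u
  rw [h1, zero_smul, zero_add] at e1
  rw [h2, zero_smul, zero_add] at e2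
  -- Both `dφ u` and `dN u` are multiples of `v^⊥`, so the factor is the quotient of coefficients
  -- unless `u = 0`.
  by_cases hb : gMet κ (crossAt κ (φ p) (N p) v) (dSph φ p u) = 0
  · have hu : u = 0 := by
      apply h.emb.immersion p
      rw [e2, hb, zero_smul, map_zero]
    exact ⟨0, by rw [hu, map_zero, zero_smul]⟩
  · refine ⟨gMet κ (crossAt κ (φ p) (N p) v) (dSph N p u) /
      gMet κ (crossAt κ (φ p) (N p) v) (dSph φ p u), ?_⟩
    conv_rhs => rw [e2]
    rw [gMet_smul_right, (h.isFrame hv).gMet_cross_cross, mul_one, smul_smul, div_mul_cancel₀ _ hb]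
    exact e1

/-- A principal vector `u` conjugate to `v` is orthogonal to `v`. -/
theorem gMet_eq_zero_of_principal (h : IsConvexSphere κ φ N) {p : Sph} {v : Amb}
    {u : EuclideanSpace ℝ (Fin 2)} {r : ℝ}
    (h1 : gMet κ v (dSph N p u) = 0) (h2 : dSph N p u = r • dSph φ p u) :
    gMet κ (dSph φ p u) v = 0 := by
  by_cases hu : u = 0
  · rw [hu, map_zero, gMet_zero_left]
  -- A zero principal curvature would contradict convexity.
  · have hr : r ≠ 0 := by
      rintro rfl
      apply h.gMet_dNormal_self_ne p hu
      rw [h2, zero_smul, gMet_zero_left]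
    rw [h2, gMet_smul_right] at h1
    rw [gMet_comm]
    exact (mul_eq_zero.1 h1).resolve_left hr

/-- At an umbilic every vector is principal, so the two alternatives yield the same pointwise
condition. -/
theorem exists_dNormal_eq_smul_of_knot (h : IsConvexSphere κ φ N) {I : Set ℝ} {q : ℝ → Sph}
    {V : ℝ → Amb} (hm : IsSmoothMapOn κ φ I q V)
    (hc : IsLineOfCurvature φ N q ∨ ∀ t, IsUmbilicAt φ N (q t)) {t : ℝ} (ht : t ∈ I) :
    ∃ r : ℝ, dSph N (q t) (dBase q t 1) = r • dSph φ (q t) (dBase q t 1) := by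
  rcases hc with hc | hc
  · obtain ⟨r, hr⟩ := hc t
    rw [deriv_sphere_comp h.emb.smooth hm ht, deriv_sphere_comp h.normal.smooth hm ht] at hr
    exact ⟨r, hr⟩
  · obtain ⟨r, hr⟩ := hc t
    exact ⟨r, hr _⟩

/-! ### The Reeb flow -/

theorem isReebVector_iff (h : IsConvexSphere κ φ N) {p : Sph} {v : Amb}
    (hv : v ∈ unitTangent κ φ p) (u : EuclideanSpace ℝ (Fin 2)) (c : ℝ) :
    IsReebVector κ φ (alphaForm κ φ N) p v (dSph φ p u, fibreVel κ φ N p v u c) ↔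
      dSph φ p u = -crossAt κ (φ p) (N p) v ∧ c = 0 := by
  have hf := h.isFrame hv
  constructor
  · rintro ⟨h1, h2⟩
    rw [alphaForm_apply] at h1
    obtain ⟨O, q, V, y, hP, hy, rfl, rfl⟩ := h.exists_isParam hv
    obtain ⟨a, rfl, rfl⟩ := h.exists_velocity hP hy u c
    have key := h2 O q V hP y hy rfl rfl a
      (by rw [h.fderiv_pair hP.1 hy, ← h.fderiv_eq_fibreVel hP.1 hy])
    simp only [h.dForm_alphaForm hP.1 hy] at key
    -- Pairing with an unrotated vector over `v` isolates `c`; pairing with the pure rotation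
    -- isolates the `v`-component of the base velocity.
    obtain ⟨u₁, hu₁, -⟩ := h.exists_dSph_coords hv 1 0
    obtain ⟨b, hb, hb'⟩ := h.exists_velocity hP hy u₁ 0
    obtain ⟨d, hd, hd'⟩ := h.exists_velocity hP hy 0 1
    have kb := key b
    have kd := key d
    rw [hb, hu₁, hb'] at kb
    rw [hd, hd', map_zero, gMet_zero_right] at kd
    refine ⟨?_, by linarith⟩
    rw [h.dSph_eq hv, show gMet κ (V y) (dSph φ (q y) (dBase q y a)) = 0 by linarith,
      show gMet κ (crossAt κ (φ (q y)) (N (q y)) (V y)) (dSph φ (q y) (dBase q y a)) = -1 by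
        linarith]
    simp
  · rintro ⟨hu, rfl⟩
    refine ⟨?_, ?_⟩
    · rw [alphaForm_apply, hu, gMet_neg_right, hf.gMet_cross_cross, neg_neg]
    · rintro O q V hP y hy rfl rfl a ha b
      rw [h.fderiv_pair hP.1 hy] at ha
      obtain ⟨ha1, ha2⟩ := Prod.mk.inj ha
      rw [h.dForm_alphaForm hP.1 hy, ha1, ha2, h.gMet_cross_fibreVel hv, hu, gMet_neg_right,
        hf.gMet_v_cross]
      ring

/-- Rotation by `90°` is an isometry with square `-1` on the tangent plane. -/
theorem deriv_eq_neg_cross_iff (h : IsConvexSphere κ φ N) {I : Set ℝ} {q : ℝ → Sph}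
    {V : ℝ → Amb} (hm : IsSmoothMapOn κ φ I q V) {t : ℝ} (ht : t ∈ I) :
    deriv (fun s => φ (q s)) t = -crossAt κ (φ (q t)) (N (q t)) (V t) ↔
      gMet κ (deriv (fun s => φ (q s)) t) (deriv (fun s => φ (q s)) t) = 1 ∧
        V t = crossAt κ (φ (q t)) (N (q t)) (deriv (fun s => φ (q s)) t) := by
  have hf := h.isFrame (hm.mem t ht)
  constructor
  · intro he
    rw [he, gMet_neg_left, gMet_neg_right, hf.gMet_cross_cross, crossAt_neg, hf.cross_n_cross]
    simp
  · rintro ⟨h1, h2⟩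
    have hz : deriv (fun s => φ (q s)) t ∈ unitTangent κ φ (q t) :=
      ⟨⟨_, (deriv_sphere_comp h.emb.smooth hm ht).symm⟩, h1⟩
    rw [h2, (h.isFrame hz).cross_n_cross, neg_neg]

theorem forall_isReebVector_iff (h : IsConvexSphere κ φ N) {I : Set ℝ} {q : ℝ → Sph}
    {V : ℝ → Amb} (hm : IsSmoothMapOn κ φ I q V) :
    (∀ t ∈ I, IsReebVector κ φ (alphaForm κ φ N) (q t) (V t)
        (deriv (fun s => φ (q s)) t, deriv V t)) ↔
      (IsSurfaceGeodesicOn κ φ I q ∧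
        ∀ t ∈ I, gMet κ (deriv (fun s => φ (q s)) t) (deriv (fun s => φ (q s)) t) = 1 ∧
          V t = crossAt κ (φ (q t)) (N (q t)) (deriv (fun s => φ (q s)) t)) := by
  have hreeb : ∀ t ∈ I, (IsReebVector κ φ (alphaForm κ φ N) (q t) (V t)
      (deriv (fun s => φ (q s)) t, deriv V t) ↔
      deriv (fun s => φ (q s)) t = -crossAt κ (φ (q t)) (N (q t)) (V t) ∧
        gMet κ (crossAt κ (φ (q t)) (N (q t)) (V t)) (fderiv ℝ V t 1) = 0) := by
    intro t ht
    rw [← fderiv_apply_one_eq_deriv (f := V), h.fderiv_eq_fibreVel hm ht,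
      deriv_sphere_comp h.emb.smooth hm ht, h.isReebVector_iff (hm.mem t ht),
      h.gMet_cross_fibreVel (hm.mem t ht)]
  -- Because `x' = -v^⊥` holds near `t`, it may be differentiated: the tangential part of `x''` is
  -- the rotation speed of `v` times `v`.
  have hgeo : (∀ t ∈ I, deriv (fun s => φ (q s)) t =
      -crossAt κ (φ (q t)) (N (q t)) (V t)) → ∀ t ∈ I, ∀ u,
      gMet κ (deriv (deriv (fun s => φ (q s))) t) (dSph φ (q t) u) =
        gMet κ (V t) (dSph φ (q t) u) *
          gMet κ (crossAt κ (φ (q t)) (N (q t)) (V t)) (fderiv ℝ V t 1) := by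
    intro hd t ht u
    have : deriv (fun s => φ (q s)) =ᶠ[nhds t]
        fun s => -crossAt κ (φ (q s)) (N (q s)) (V s) := by
      filter_upwards [hm.isOpen.mem_nhds ht] with s hs using hd s hs
    rw [this.deriv_eq, deriv.fun_neg, gMet_neg_left, ← fderiv_apply_one_eq_deriv,
      h.gMet_fderiv_cross hm ht, neg_neg]
  constructor
  · intro hr
    have hd := fun t ht => ((hreeb t ht).1 (hr t ht)).1
    refine ⟨fun t ht u => ?_, fun t ht => (h.deriv_eq_neg_cross_iff hm ht).1 (hd t ht)⟩
    rw [hgeo hd t ht, ((hreeb t ht).1 (hr t ht)).2, mul_zero]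
  · rintro ⟨hg, hu⟩ t ht
    have hd := fun t ht => (h.deriv_eq_neg_cross_iff hm ht).2 (hu t ht)
    refine (hreeb t ht).2 ⟨hd t ht, ?_⟩
    -- Testing the geodesic equation against `v` reads off the rotation speed.
    obtain ⟨u, hu₁, -⟩ := h.exists_dSph_coords (hm.mem t ht) 1 0
    have := hg t ht u
    rwa [hgeo hd t ht, hu₁, one_mul] at this

end IsConvexSphere

end

/-! ### Assembly of the four claims -/

theorem theorem2 (κ : ℝ) (hκ : κ = 0 ∨ κ = 1 ∨ κ = -1) (φ N : Sph → Amb)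
    (hφ : IsEmbeddedSphere κ φ) (hN : IsUnitNormal κ φ N) (hS : IsStrictlyConvex κ φ N) :
    ∃ A B : Sph → Amb → Submodule ℝ Biv,
      -- `H(S)` is null; `A` and `B` are its unique fields of `α`-planes and `β`-planes
      (∀ p, ∀ v ∈ unitTangent κ φ p,
        IsNullAt κ φ p v ∧
        (∀ P : Submodule ℝ Biv,
          (IsAlphaPlane κ (φ p) v P ∧ (P : Set Biv) ⊆ hypTangent κ φ p v) ↔ P = A p v) ∧
        (∀ P : Submodule ℝ Biv,
          (IsBetaPlane κ (φ p) v P ∧ (P : Set Biv) ⊆ hypTangent κ φ p v) ↔ P = B p v)) ∧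
      -- both are contact
      IsContact κ φ A ∧ IsContact κ φ B ∧
      -- `α`-Legendrian knots
      (∀ q v, IsKnot κ φ q v →
        (IsLegendrian φ A q v ↔ IsTangentToContactCurve φ q v)) ∧
      -- `β`-Legendrian knots: any two of the three conditions imply the third
      (∀ q v, IsKnot κ φ q v →
        (IsLegendrian φ B q v → IsNormalToContactCurve κ φ q v →
          (IsLineOfCurvature φ N q ∨ ∀ t, IsUmbilicAt φ N (q t))) ∧
        (IsLegendrian φ B q v → (IsLineOfCurvature φ N q ∨ ∀ t, IsUmbilicAt φ N (q t)) →
          IsNormalToContactCurve κ φ q v) ∧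
        (IsNormalToContactCurve κ φ q v →
          (IsLineOfCurvature φ N q ∨ ∀ t, IsUmbilicAt φ N (q t)) →
          IsLegendrian φ B q v)) ∧
      -- the Reeb flow of the `α`-planes: the integral curves are the families of oriented
      -- geodesics normal to the unit speed geodesics of `S`
      (IsDefiningForm κ φ A (alphaForm κ φ N) ∧ IsContactForm κ φ (alphaForm κ φ N) ∧
        ∀ (I : Set ℝ) (q : ℝ → Sph) (v : ℝ → Amb), IsSmoothMapOn κ φ I q v →
          ((∀ t ∈ I, IsReebVector κ φ (alphaForm κ φ N) (q t) (v t)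
              (deriv (fun s => φ (q s)) t, deriv v t)) ↔
            (IsSurfaceGeodesicOn κ φ I q ∧
              ∀ t ∈ I, gMet κ (deriv (fun s => φ (q s)) t) (deriv (fun s => φ (q s)) t) = 1 ∧
                v t = crossAt κ (φ (q t)) (N (q t)) (deriv (fun s => φ (q s)) t)))) := by
  have h : IsConvexSphere κ φ N := ⟨hκ, hφ, hN, hS⟩
  refine ⟨fun p v => alphaPlane κ (φ p) (N p) v, fun p v => betaPlane κ (φ p) (N p) v,
    fun p v hv => ⟨h.isNullAt hv, ?_, ?_⟩, ⟨_, h.isDefiningForm_alphaForm,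
      h.isContactForm_alphaForm⟩, ⟨_, h.isDefiningForm_betaForm, h.isContactForm_betaForm⟩,
    -- The first alternative always suffices here, since being principal is a pointwise condition
    -- that also holds at umbilics and at points of zero contact velocity.
    fun q v hk => ?_, fun q v hk => ⟨fun h1 h2 => Or.inl fun t => ?_, fun h1 h2 t => ?_,
      fun h1 h2 t => ?_⟩,
    h.isDefiningForm_alphaForm, h.isContactForm_alphaForm,
    fun I q v hm => h.forall_isReebVector_iff hm⟩
  · rw [h.hypTangent_eq hv]
    exact (h.isFrame hv).isAlphaPlane_iff
  · rw [h.hypTangent_eq hv]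
    exact (h.isFrame hv).isBetaPlane_iff
  · exact forall_congr' fun t => h.deriv_wedge_mem_alphaPlane hk.smooth (Set.mem_univ t)
  · have ht := Set.mem_univ t
    have e1 := (h.deriv_wedge_mem_betaPlane hk.smooth ht).1 (h1 t)
    have e2 := h2 t
    rw [IsConvexSphere.deriv_sphere_comp hφ.smooth hk.smooth ht] at e2 ⊢
    rw [IsConvexSphere.deriv_sphere_comp hN.smooth hk.smooth ht]
    exact h.exists_dNormal_eq_smul (hk.smooth.mem t ht) e1 e2
  · have ht := Set.mem_univ t
    have e1 := (h.deriv_wedge_mem_betaPlane hk.smooth ht).1 (h1 t)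
    obtain ⟨r, hr⟩ := h.exists_dNormal_eq_smul_of_knot hk.smooth h2 ht
    rw [IsConvexSphere.deriv_sphere_comp hφ.smooth hk.smooth ht]
    exact h.gMet_eq_zero_of_principal e1 hr
  · have ht := Set.mem_univ t
    obtain ⟨r, hr⟩ := h.exists_dNormal_eq_smul_of_knot hk.smooth h2 ht
    have e1 := h1 t
    rw [IsConvexSphere.deriv_sphere_comp hφ.smooth hk.smooth ht, gMet_comm] at e1
    refine (h.deriv_wedge_mem_betaPlane hk.smooth ht).2 ?_
    rw [hr, gMet_smul_right, e1, mul_zero]
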